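/- **Definitions.** A continuous function $g:\mathbb R\to\mathbb C$ is almost automorphic ($g\in\mathcal C_{aa}$) if every real sequence $(s_m)$ has a subsequence $(s_{m_k})$ such that $\tilde g(x):=\lim_k g(x+s_{m_k})$ exists and $\lim_k\tilde g(x-s_{m_k})=g(x)$ for every $x\in\mathbb R$. A bounded continuous $f:\mathbb R\to\mathbb C$ is asymptotically almost automorphic ($f\in\mathcal C_{aaa}$) if $f=g+h$ on $[0,+\infty[$ for some $g\in\mathcal C_{aa}$ and some bounded continuous $h:\mathbb R\to\mathbb C$ with $\lim_{x\to+\infty}h(x)=0$. Let $$\mathcal B_{aaa}:=\{f\in C^\infty(\mathbb R,\mathbb C): f^{(j)}\in\mathcal C_{aaa}\ \text{for all } j\ge 0\},\qquad |f|_{k,\infty}:=\sum_{j\le k}\|f^{(j)}\|_{L^\infty(\mathbb R)} .$$ Let $\mathcal D_{L^1}$ be the space of $\psi\in C^\infty(\mathbb R,\mathbb C)$ with $\psi^{(j)}\in L^1(\mathbb R)$ for all $j\ge 0$, with the topology of the seminorms $\sum_{j\le k}\|\psi^{(j)}\|_{L^1}$, $k\ge 0$, and let $\mathcal B'$ be its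 topological dual. For $T\in\mathcal B'$ put $\langle T^{(j)},\psi\rangle=(-1)^j\langle T,\psi^{(j)}\rangle$ and, for $\varphi\in\mathcal D_{L^1}$, $(T*\varphi)(x)=\langle T,\varphi(x-\cdot)\rangle$. The space $\mathcal B'_{aaa}$ of asymptotically almost automorphic distributions is the set of $T\in\mathcal B'$ of the form $T=\sum_{j=0}^k f_j^{(j)}$ with $k\ge 0$ and $f_0,\dots,f_k\in\mathcal C_{aaa}$, that is, $\langle T,\psi\rangle=\sum_{j=0}^k(-1)^j\int_{\mathbb R} f_j\psi^{(j)}\,dx$ for all $\psi\in\mathcal D_{L^1}$. Let $I=\,]0,1]$. For $a:I\to\mathbb R$ and $m\in\mathbb Z$, $a_\varepsilon=O(\varepsilon^m)$ means that there are $c>0$ and $\varepsilon_0\in I$ with $a_\varepsilon\le c\,\varepsilon^m$ for all $\varepsilon\in I$, $\varepsilon<\varepsilon_0$. Let $\mathcal M_{aaa}$ be the algebra of families $(u_\varepsilon)_\varepsilon\in(\mathcal B_{aaa})^I$ such that for every $k\ge 0$ there is $m\ge 0$ with $|u_\varepsilon|_{k,\infty}=O(\varepsilon^{-m})$, let $\mathcal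 N_{aaa}$ be its ideal of families with $|u_\varepsilon|_{k,\infty}=O(\varepsilon^{m})$ for all $k,m\ge 0$, and let $\mathcal G_{aaa}:=\mathcal M_{aaa}/\mathcal N_{aaa}$, with derivatives $[(u_\varepsilon)_\varepsilon]^{(j)}:=[(u_\varepsilon^{(j)})_\varepsilon]$. **Proposition 3.3.** Let $\rho\in\mathcal S(\mathbb R)$ (complex-valued) satisfy $\int_{\mathbb R}\rho(x)\,dx=1$ and $\int_{\mathbb R}x^k\rho(x)\,dx=0$ for all integers $k\ge 1$, and let $\rho_\varepsilon(x)=\frac1\varepsilon\rho(\frac x\varepsilon)$. Then the maps $$\sigma_{aaa}:\mathcal B_{aaa}\to\mathcal G_{aaa},\ f\mapsto[(f)_\varepsilon];\qquad \gamma_{aaa}:\mathcal B_{aaa}\to\mathcal B'_{aaa},\ \langle\gamma_{aaa}(f),\psi\rangle=\int_{\mathbb R} f\psi\,dx;\qquad \iota_{aaa}:\mathcal B'_{aaa}\to\mathcal G_{aaa},\ T\mapsto[(T*\rho_\varepsilon)_\varepsilon]$$ are well defined (in particular $(T*\rho_\varepsilon)_{\varepsilon}\in\mathcal M_{aaa}$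 for every $T\in\mathcal B'_{aaa}$), linear and injective, and the diagram they form commutes: $\iota_{aaa}\circ\gamma_{aaa}=\sigma_{aaa}$. Moreover $\iota_{aaa}(T^{(j)})=(\iota_{aaa}(T))^{(j)}$ for all $T\in\mathcal B'_{aaa}$ and all $j\ge 0$. -/

import Mathlib

open MeasureTheory Filter Topology
open scoped ContDiff SchwartzMap

noncomputable section

namespace AAA

/-! ### Almost automorphic and asymptotically almost automorphic functions -/

/-- The space `C_aa` of (Bochner) almost automorphic functions on `ℝ`. -/
def IsAlmostAutomorphic (g : ℝ → ℂ) : Prop :=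
  Continuous g ∧ ∀ s : ℕ → ℝ, ∃ φ : ℕ → ℕ, StrictMono φ ∧ ∃ g' : ℝ → ℂ,
    (∀ x, Tendsto (fun k => g (x + s (φ k))) atTop (𝓝 (g' x))) ∧
    (∀ x, Tendsto (fun k => g' (x - s (φ k))) atTop (𝓝 (g x)))

/-- Bounded and continuous complex-valued functions on `ℝ`: the space `C_b`. -/
def IsBddCont (f : ℝ → ℂ) : Prop :=
  Continuous f ∧ ∃ C : ℝ, ∀ x, ‖f x‖ ≤ C

/-- The space `C_{+,0}` of bounded continuous functions vanishing at `+∞`. -/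
def VanishesAtPosInfty (h : ℝ → ℂ) : Prop :=
  IsBddCont h ∧ Tendsto h atTop (𝓝 0)

/-- The space `C_aaa` of asymptotically almost automorphic functions: `f ∈ C_b` such that
`f = g + h` on `[0, +∞[` with `g ∈ C_aa` and `h ∈ C_{+,0}`. -/
def IsAAA (f : ℝ → ℂ) : Prop :=
  IsBddCont f ∧ ∃ g h : ℝ → ℂ, IsAlmostAutomorphic g ∧ VanishesAtPosInfty h ∧
    ∀ x, 0 ≤ x → f x = g x + h x

theorem IsBddCont.add {f g : ℝ → ℂ} (hf : IsBddCont f) (hg : IsBddCont g) :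
    IsBddCont (fun x => f x + g x) := by
  obtain ⟨hf, C, hC⟩ := hf
  obtain ⟨hg, D, hD⟩ := hg
  exact ⟨hf.add hg, C + D, fun x => (norm_add_le _ _).trans (add_le_add (hC x) (hD x))⟩

theorem IsBddCont.mul {f g : ℝ → ℂ} (hf : IsBddCont f) (hg : IsBddCont g) :
    IsBddCont (fun x => f x * g x) := by
  obtain ⟨hf, C, hC⟩ := hf
  obtain ⟨hg, D, hD⟩ := hg
  refine ⟨hf.mul hg, C * D, fun x => ?_⟩
  rw [norm_mul]
  exact mul_le_mul (hC x) (hD x) (norm_nonneg _) ((norm_nonneg _).trans (hC x))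

theorem IsBddCont.const (c : ℂ) : IsBddCont (fun _ => c) :=
  ⟨continuous_const, ‖c‖, fun _ => le_rfl⟩

theorem IsAlmostAutomorphic.isBddCont {g : ℝ → ℂ} (hg : IsAlmostAutomorphic g) :
    IsBddCont g := by
  refine ⟨hg.1, ?_⟩
  by_contra! h
  choose s hs using fun n : ℕ => h n
  obtain ⟨φ, hφ, g', h1, -⟩ := hg.2 s
  have h2 := (h1 0).norm
  have h3 : Tendsto (fun k => ‖g (0 + s (φ k))‖) atTop atTop := by
    refine tendsto_atTop_mono (fun k => ?_)
      (tendsto_natCast_atTop_atTop.comp hφ.tendsto_atTop)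
    simpa using (hs (φ k)).le
  exact not_tendsto_nhds_of_tendsto_atTop h3 _ h2

theorem IsAlmostAutomorphic.binop {f g : ℝ → ℂ} (op : ℂ → ℂ → ℂ)
    (hop : Continuous fun p : ℂ × ℂ => op p.1 p.2)
    (hf : IsAlmostAutomorphic f) (hg : IsAlmostAutomorphic g) :
    IsAlmostAutomorphic (fun x => op (f x) (g x)) := by
  refine ⟨hop.comp (hf.1.prodMk hg.1), fun s => ?_⟩
  obtain ⟨φ, hφ, f', h1, h2⟩ := hf.2 s
  obtain ⟨ψ, hψ, g', h3, h4⟩ := hg.2 (s ∘ φ)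
  refine ⟨φ ∘ ψ, hφ.comp hψ, fun x => op (f' x) (g' x), fun x => ?_, fun x => ?_⟩
  · exact (hop.tendsto (f' x, g' x)).comp
      (((h1 x).comp hψ.tendsto_atTop).prodMk_nhds (h3 x))
  · exact (hop.tendsto (f x, g x)).comp
      (((h2 x).comp hψ.tendsto_atTop).prodMk_nhds (h4 x))

theorem IsAlmostAutomorphic.const (c : ℂ) : IsAlmostAutomorphic (fun _ => c) :=
  ⟨continuous_const, fun _ => ⟨id, strictMono_id, fun _ => c,
    fun _ => tendsto_const_nhds, fun _ => tendsto_const_nhds⟩⟩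

theorem VanishesAtPosInfty.add {f g : ℝ → ℂ} (hf : VanishesAtPosInfty f)
    (hg : VanishesAtPosInfty g) : VanishesAtPosInfty (fun x => f x + g x) :=
  ⟨hf.1.add hg.1, by simpa using hf.2.add hg.2⟩

theorem VanishesAtPosInfty.mul_left {f g : ℝ → ℂ} (hf : IsBddCont f)
    (hg : VanishesAtPosInfty g) : VanishesAtPosInfty (fun x => f x * g x) := by
  refine ⟨hf.mul hg.1, ?_⟩
  obtain ⟨C, hC⟩ := hf.2
  refine squeeze_zero_norm (a := fun x => C * ‖g x‖) (fun x => ?_) ?_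
  · rw [norm_mul]
    exact mul_le_mul_of_nonneg_right (hC x) (norm_nonneg _)
  · simpa using hg.2.norm.const_mul C

theorem IsAAA.const (c : ℂ) : IsAAA (fun _ => c) :=
  ⟨IsBddCont.const c, fun _ => c, fun _ => 0, IsAlmostAutomorphic.const c,
    ⟨IsBddCont.const 0, tendsto_const_nhds⟩, fun _ _ => by simp⟩

theorem IsAAA.add {f₁ f₂ : ℝ → ℂ} (h₁ : IsAAA f₁) (h₂ : IsAAA f₂) :
    IsAAA (fun x => f₁ x + f₂ x) := by
  obtain ⟨b₁, g₁, k₁, hg₁, hk₁, e₁⟩ := h₁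
  obtain ⟨b₂, g₂, k₂, hg₂, hk₂, e₂⟩ := h₂
  refine ⟨b₁.add b₂, _, _, hg₁.binop (· + ·) (by fun_prop) hg₂, hk₁.add hk₂, fun x hx => ?_⟩
  simp only [e₁ x hx, e₂ x hx]
  ring

theorem IsAAA.mul {f₁ f₂ : ℝ → ℂ} (h₁ : IsAAA f₁) (h₂ : IsAAA f₂) :
    IsAAA (fun x => f₁ x * f₂ x) := by
  obtain ⟨b₁, g₁, k₁, hg₁, hk₁, e₁⟩ := h₁
  obtain ⟨b₂, g₂, k₂, hg₂, hk₂, e₂⟩ := h₂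
  refine ⟨b₁.mul b₂, _, _, hg₁.binop (· * ·) (by fun_prop) hg₂,
    (VanishesAtPosInfty.mul_left hg₁.isBddCont hk₂).add
      ((VanishesAtPosInfty.mul_left hg₂.isBddCont hk₁).add
        (VanishesAtPosInfty.mul_left hk₁.1 hk₂)), fun x hx => ?_⟩
  simp only [e₁ x hx, e₂ x hx]
  ring

theorem IsAAA.sum {ι : Type*} (s : Finset ι) {f : ι → ℝ → ℂ} (h : ∀ i ∈ s, IsAAA (f i)) :
    IsAAA (fun x => ∑ i ∈ s, f i x) := by
  classical
  induction s using Finset.induction_on with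
  | empty => simpa using IsAAA.const 0
  | insert a s ha ih =>
    simp only [Finset.sum_insert ha]
    exact (h a (by simp)).add (ih fun i hi => h i (by simp [hi]))

theorem iteratedDeriv_add_index (i j : ℕ) (f : ℝ → ℂ) :
    iteratedDeriv i (iteratedDeriv j f) = iteratedDeriv (i + j) f := by
  simp only [iteratedDeriv_eq_iterate, Function.iterate_add_apply]

theorem contDiff_iteratedDeriv {f : ℝ → ℂ} (hf : ContDiff ℝ ∞ f) (j : ℕ) :
    ContDiff ℝ ∞ (iteratedDeriv j f) := by
  rw [iteratedDeriv_eq_iterate]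
  exact hf.iterate_deriv j

theorem contDiffAt_nat {f : ℝ → ℂ} (hf : ContDiff ℝ ∞ f) (j : ℕ) (x : ℝ) :
    ContDiffAt ℝ j f x :=
  (hf.of_le (by exact_mod_cast le_top)).contDiffAt

/-- The algebra `B_aaa` of smooth functions all of whose derivatives are asymptotically almost
automorphic. -/
def Baaa : Subalgebra ℂ (ℝ → ℂ) where
  carrier := {f | ContDiff ℝ ∞ f ∧ ∀ j : ℕ, IsAAA (iteratedDeriv j f)}
  add_mem' := by
    rintro f g ⟨hf, hf'⟩ ⟨hg, hg'⟩
    refine ⟨hf.add hg, fun j => ?_⟩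
    have : iteratedDeriv j (f + g) = fun x => iteratedDeriv j f x + iteratedDeriv j g x :=
      funext fun x => iteratedDeriv_add (contDiffAt_nat hf j x) (contDiffAt_nat hg j x)
    rw [this]
    exact (hf' j).add (hg' j)
  mul_mem' := by
    rintro f g ⟨hf, hf'⟩ ⟨hg, hg'⟩
    refine ⟨hf.mul hg, fun j => ?_⟩
    have : iteratedDeriv j (f * g) = fun x => ∑ i ∈ Finset.range (j + 1),
        (j.choose i : ℂ) * iteratedDeriv i f x * iteratedDeriv (j - i) g x :=
      funext fun x => iteratedDeriv_mul (contDiffAt_nat hf j x) (contDiffAt_nat hg j x)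
    rw [this]
    exact IsAAA.sum _ fun i _ => ((IsAAA.const _).mul (hf' i)).mul (hg' _)
  algebraMap_mem' := by
    intro c
    refine ⟨contDiff_const, fun j => ?_⟩
    have : iteratedDeriv j (algebraMap ℂ (ℝ → ℂ) c) = fun _ => if j = 0 then c else 0 := by
      funext x
      exact iteratedDeriv_const
    rw [this]
    exact IsAAA.const _

/-- The derivation `f ↦ f^{(j)}` of `B_aaa`. -/
def Baaa.iterD (j : ℕ) : Baaa →ₗ[ℂ] Baaa where
  toFun f := ⟨iteratedDeriv j (f : ℝ → ℂ), contDiff_iteratedDeriv f.2.1 j, fun i => by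
    rw [iteratedDeriv_add_index]
    exact f.2.2 _⟩
  map_add' f g := Subtype.ext <| funext fun x =>
    iteratedDeriv_add (contDiffAt_nat f.2.1 j x) (contDiffAt_nat g.2.1 j x)
  map_smul' c f := Subtype.ext <| funext fun _ =>
    iteratedDeriv_const_smul_field c (f : ℝ → ℂ)

/-! ### The seminorms of `B` -/

/-- `‖f‖_{L^∞(ℝ)}`, for a continuous function `f`, as a supremum. -/
def supNorm (f : ℝ → ℂ) : ℝ := ⨆ x, ‖f x‖

/-- The seminorm `|f|_{k,∞,ℝ} = ∑_{j ≤ k} ‖f^{(j)}‖_{L^∞(ℝ)}`. -/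
def normK (k : ℕ) (f : ℝ → ℂ) : ℝ :=
  ∑ j ∈ Finset.range (k + 1), supNorm (iteratedDeriv j f)

theorem supNorm_nonneg (f : ℝ → ℂ) : 0 ≤ supNorm f :=
  Real.iSup_nonneg fun _ => norm_nonneg _

theorem le_supNorm {f : ℝ → ℂ} (hf : IsBddCont f) (x : ℝ) : ‖f x‖ ≤ supNorm f := by
  obtain ⟨C, hC⟩ := hf.2
  exact le_ciSup (f := fun x => ‖f x‖) ⟨C, by rintro _ ⟨y, rfl⟩; exact hC y⟩ x

theorem supNorm_le {f : ℝ → ℂ} {C : ℝ} (h : ∀ x, ‖f x‖ ≤ C) : supNorm f ≤ C :=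
  ciSup_le h

theorem normK_nonneg (k : ℕ) (f : ℝ → ℂ) : 0 ≤ normK k f :=
  Finset.sum_nonneg fun _ _ => supNorm_nonneg _

theorem supNorm_le_normK {j k : ℕ} (h : j ≤ k) (f : ℝ → ℂ) :
    supNorm (iteratedDeriv j f) ≤ normK k f :=
  Finset.single_le_sum (f := fun j => supNorm (iteratedDeriv j f))
    (fun _ _ => supNorm_nonneg _) (Finset.mem_range.2 (Nat.lt_succ_of_le h))

theorem normK_add_le (k : ℕ) (f g : Baaa) :
    normK k ((f + g : Baaa) : ℝ → ℂ) ≤ normK k f + normK k g := by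
  unfold normK
  rw [← Finset.sum_add_distrib]
  refine Finset.sum_le_sum fun j _ => supNorm_le fun x => ?_
  have : iteratedDeriv j ((f + g : Baaa) : ℝ → ℂ) x
      = iteratedDeriv j (f : ℝ → ℂ) x + iteratedDeriv j (g : ℝ → ℂ) x :=
    iteratedDeriv_add (contDiffAt_nat f.2.1 j x) (contDiffAt_nat g.2.1 j x)
  rw [this]
  exact (norm_add_le _ _).trans
    (add_le_add (le_supNorm (f.2.2 j).1 x) (le_supNorm (g.2.2 j).1 x))

theorem normK_mul_le (k : ℕ) (f g : Baaa) :
    normK k ((f * g : Baaa) : ℝ → ℂ) ≤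
      (∑ j ∈ Finset.range (k + 1), (2 : ℝ) ^ j) * (normK k f * normK k g) := by
  rw [Finset.sum_mul]
  refine Finset.sum_le_sum fun j hj => supNorm_le fun x => ?_
  have hj' : j ≤ k := Nat.lt_succ_iff.1 (Finset.mem_range.1 hj)
  have : iteratedDeriv j ((f * g : Baaa) : ℝ → ℂ) x
      = ∑ i ∈ Finset.range (j + 1), (j.choose i : ℂ) * iteratedDeriv i (f : ℝ → ℂ) x
        * iteratedDeriv (j - i) (g : ℝ → ℂ) x :=
    iteratedDeriv_mul (contDiffAt_nat f.2.1 j x) (contDiffAt_nat g.2.1 j x)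
  rw [this]
  have h2 : (2 : ℝ) ^ j = ∑ i ∈ Finset.range (j + 1), (j.choose i : ℝ) := by
    exact_mod_cast (Nat.sum_range_choose j).symm
  rw [h2, Finset.sum_mul]
  refine (norm_sum_le _ _).trans (Finset.sum_le_sum fun i hi => ?_)
  have hi' : i ≤ j := Nat.lt_succ_iff.1 (Finset.mem_range.1 hi)
  rw [norm_mul, norm_mul, Complex.norm_natCast, mul_assoc]
  refine mul_le_mul_of_nonneg_left (mul_le_mul ?_ ?_ (norm_nonneg _) (normK_nonneg _ _))
    (Nat.cast_nonneg _)
  · exact (le_supNorm (f.2.2 i).1 x).trans (supNorm_le_normK (hi'.trans hj') _)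
  · exact (le_supNorm (g.2.2 _).1 x).trans (supNorm_le_normK ((Nat.sub_le _ _).trans hj') _)

theorem normK_iterD_le (k j : ℕ) (f : Baaa) :
    normK k (Baaa.iterD j f : ℝ → ℂ) ≤ (k + 1) * normK (k + j) f := by
  have : ∀ i ∈ Finset.range (k + 1),
      supNorm (iteratedDeriv i (Baaa.iterD j f : ℝ → ℂ)) ≤ normK (k + j) f := by
    intro i hi
    have hi' : i ≤ k := Nat.lt_succ_iff.1 (Finset.mem_range.1 hi)
    change supNorm (iteratedDeriv i (iteratedDeriv j (f : ℝ → ℂ))) ≤ _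
    rw [iteratedDeriv_add_index]
    exact supNorm_le_normK (by omega) _
  simpa [normK] using Finset.sum_le_sum this

theorem normK_algebraMap_le (k : ℕ) (c : ℂ) :
    normK k (algebraMap ℂ Baaa c : ℝ → ℂ) ≤ (k + 1) * ‖c‖ := by
  have : ∀ i ∈ Finset.range (k + 1),
      supNorm (iteratedDeriv i (algebraMap ℂ Baaa c : ℝ → ℂ)) ≤ ‖c‖ := by
    intro i _
    refine supNorm_le fun x => ?_
    have : iteratedDeriv i (algebraMap ℂ Baaa c : ℝ → ℂ) x = if i = 0 then c else 0 :=
      iteratedDeriv_const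
    rw [this]
    split_ifs <;> simp
  simpa [normK] using Finset.sum_le_sum this

/-! ### The algebra of generalized functions -/

/-- The parameter set `I = ]0, 1]`. -/
abbrev I : Type := Set.Ioc (0 : ℝ) 1

/-- `a_ε = O(ε^m)` as `ε → 0`: there are `c > 0` and `ε₀ ∈ I` with `a_ε ≤ c ε^m` for all
`ε ∈ I`, `ε < ε₀`. -/
def IsOPow (a : I → ℝ) (m : ℤ) : Prop :=
  ∃ c : ℝ, 0 < c ∧ ∃ ε₀ : I, ∀ ε : I, ε < ε₀ → a ε ≤ c * (ε : ℝ) ^ m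

theorem IsOPow.mono {a b : I → ℝ} {m n : ℤ} (h : IsOPow a m) (hab : ∀ ε, b ε ≤ a ε)
    (hmn : n ≤ m) : IsOPow b n := by
  obtain ⟨c, hc, ε₀, H⟩ := h
  refine ⟨c, hc, ε₀, fun ε hε => (hab ε).trans ((H ε hε).trans ?_)⟩
  exact mul_le_mul_of_nonneg_left (zpow_le_zpow_right_of_le_one₀ ε.2.1 ε.2.2 hmn) hc.le

theorem IsOPow.add {a b : I → ℝ} {m : ℤ} (h : IsOPow a m) (h' : IsOPow b m) :
    IsOPow (fun ε => a ε + b ε) m := by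
  obtain ⟨c, hc, ε₀, H⟩ := h
  obtain ⟨c', hc', ε₀', H'⟩ := h'
  refine ⟨c + c', add_pos hc hc', min ε₀ ε₀', fun ε hε => ?_⟩
  rw [add_mul]
  exact add_le_add (H ε (hε.trans_le (min_le_left _ _))) (H' ε (hε.trans_le (min_le_right _ _)))

theorem IsOPow.mul {a b : I → ℝ} {m n : ℤ} (h : IsOPow a m) (h' : IsOPow b n)
    (hb : ∀ ε, 0 ≤ b ε) : IsOPow (fun ε => a ε * b ε) (m + n) := by
  obtain ⟨c, hc, ε₀, H⟩ := h
  obtain ⟨c', hc', ε₀', H'⟩ := h'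
  refine ⟨c * c', mul_pos hc hc', min ε₀ ε₀', fun ε hε => ?_⟩
  have h1 := H ε (hε.trans_le (min_le_left _ _))
  have h2 := H' ε (hε.trans_le (min_le_right _ _))
  have h3 : (0 : ℝ) ≤ c * (ε : ℝ) ^ m := mul_nonneg hc.le (zpow_nonneg ε.2.1.le _)
  refine (mul_le_mul h1 h2 (hb ε) h3).trans (le_of_eq ?_)
  rw [zpow_add₀ ε.2.1.ne']
  ring

theorem IsOPow.const_mul {a : I → ℝ} {m : ℤ} (h : IsOPow a m) {C : ℝ} (hC : 0 < C) :
    IsOPow (fun ε => C * a ε) m := by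
  obtain ⟨c, hc, ε₀, H⟩ := h
  refine ⟨C * c, mul_pos hC hc, ε₀, fun ε hε => ?_⟩
  rw [mul_assoc]
  exact mul_le_mul_of_nonneg_left (H ε hε) hC.le

theorem IsOPow.const {C : ℝ} (hC : 0 ≤ C) : IsOPow (fun _ => C) 0 :=
  ⟨C + 1, by linarith, ⟨1, by norm_num⟩, fun _ _ => by simp⟩

/-- `(u_ε)_ε ∈ (B_aaa)^I` is moderate: `∀ k, ∃ m, |u_ε|_{k,∞} = O(ε^{-m})`. -/
def IsModerate (u : I → Baaa) : Prop :=
  ∀ k : ℕ, ∃ m : ℕ, IsOPow (fun ε => normK k (u ε)) (-(m : ℤ))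

/-- `(u_ε)_ε ∈ (B_aaa)^I` is null: `∀ k, ∀ m, |u_ε|_{k,∞} = O(ε^m)`. -/
def IsNull (u : I → Baaa) : Prop :=
  ∀ k m : ℕ, IsOPow (fun ε => normK k (u ε)) (m : ℤ)

theorem sum_two_pow_pos (k : ℕ) : (0 : ℝ) < ∑ j ∈ Finset.range (k + 1), (2 : ℝ) ^ j :=
  Finset.sum_pos (fun _ _ => by positivity) ⟨0, by simp⟩

/-- The moderate families form a subalgebra of `(B_aaa)^I`. -/
def MaaaSub : Subalgebra ℂ (I → Baaa) where
  carrier := {u | IsModerate u}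
  add_mem' := by
    intro u v hu hv k
    obtain ⟨m, hm⟩ := hu k
    obtain ⟨n, hn⟩ := hv k
    refine ⟨m + n, IsOPow.mono (IsOPow.add
      (hm.mono (fun _ => le_rfl) (n := -((m + n : ℕ) : ℤ)) (by push_cast; omega))
      (hn.mono (fun _ => le_rfl) (n := -((m + n : ℕ) : ℤ)) (by push_cast; omega)))
      (fun ε => normK_add_le k (u ε) (v ε)) le_rfl⟩
  mul_mem' := by
    intro u v hu hv k
    obtain ⟨m, hm⟩ := hu k
    obtain ⟨n, hn⟩ := hv k
    exact ⟨m + n, ((hm.mul hn fun ε => normK_nonneg _ _).const_mul (sum_two_pow_pos k)).mono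
      (fun ε => normK_mul_le k (u ε) (v ε)) (by push_cast; omega)⟩
  algebraMap_mem' := by
    intro c k
    refine ⟨0, (IsOPow.const (C := (k + 1) * ‖c‖) (by positivity)).mono
      (fun ε => normK_algebraMap_le k c) (by simp)⟩

/-- The algebra `M_aaa` of moderate families. -/
def Maaa : Type := MaaaSub

instance : CommRing Maaa := inferInstanceAs (CommRing MaaaSub)
instance : Algebra ℂ Maaa := inferInstanceAs (Algebra ℂ MaaaSub)
instance : FunLike Maaa I Baaa := ⟨fun u => Subtype.val (p := (· ∈ MaaaSub)) u,
  Subtype.val_injective⟩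

/-- A moderate family as an element of `M_aaa`. -/
def Maaa.ofFun (u : I → Baaa) (hu : IsModerate u) : Maaa := (⟨u, hu⟩ : MaaaSub)

theorem Maaa.isModerate (u : Maaa) : IsModerate u := u.2

@[simp] theorem Maaa.coe_ofFun (u : I → Baaa) (hu : IsModerate u) :
    (Maaa.ofFun u hu : I → Baaa) = u := rfl

@[simp] theorem Maaa.coe_zero : ((0 : Maaa) : I → Baaa) = 0 := rfl

@[simp] theorem Maaa.coe_add (u v : Maaa) : ((u + v : Maaa) : I → Baaa) = (u : I → Baaa) + v := rfl

@[simp] theorem Maaa.coe_sub (u v : Maaa) : ((u - v : Maaa) : I → Baaa) = (u : I → Baaa) - v := rfl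

@[simp] theorem Maaa.coe_mul (u v : Maaa) : ((u * v : Maaa) : I → Baaa) = (u : I → Baaa) * v := rfl

@[simp] theorem Maaa.coe_smul (c : ℂ) (u : Maaa) :
    ((c • u : Maaa) : I → Baaa) = c • (u : I → Baaa) := rfl

/-- The ideal `N_aaa` of null families. -/
def Naaa : Ideal Maaa where
  carrier := {u | IsNull (u : I → Baaa)}
  add_mem' := by
    intro u v hu hv k m
    exact ((hu k m).add (hv k m)).mono (fun ε => normK_add_le k _ _) le_rfl
  zero_mem' := by
    intro k m
    refine ⟨1, one_pos, ⟨1, by norm_num⟩, fun ε _ => ?_⟩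
    have h := normK_algebraMap_le k 0
    rw [norm_zero, mul_zero, map_zero] at h
    exact h.trans (mul_nonneg one_pos.le (zpow_nonneg ε.2.1.le _))
  smul_mem' := by
    intro u v hv k m
    obtain ⟨n, hn⟩ := u.isModerate k
    exact ((hn.mul (hv k (m + n)) fun ε => normK_nonneg _ _).const_mul
      (sum_two_pow_pos k)).mono (fun ε => normK_mul_le k _ _) (by push_cast; omega)

/-- The algebra `G_aaa = M_aaa / N_aaa` of asymptotically almost automorphic generalized
functions. -/
abbrev Gaaa : Type := Maaa ⧸ Naaa

/-- The class `[(u_ε)_ε] = (u_ε)_ε + N_aaa`. -/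
def Gaaa.mk : Maaa →ₐ[ℂ] Gaaa := Ideal.Quotient.mkₐ ℂ Naaa

/-- `(u_ε)_ε ↦ (u_ε^{(j)})_ε` on moderate families. -/
def Maaa.iterD (j : ℕ) : Maaa →ₗ[ℂ] Maaa where
  toFun u := Maaa.ofFun (fun ε => Baaa.iterD j (u ε)) fun k => by
    obtain ⟨m, hm⟩ := u.isModerate (k + j)
    exact ⟨m, (hm.const_mul (C := (k : ℝ) + 1) (by positivity)).mono
      (fun ε => normK_iterD_le k j _) le_rfl⟩
  map_add' u v := DFunLike.ext _ _ fun ε => (Baaa.iterD j).map_add _ _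
  map_smul' c u := DFunLike.ext _ _ fun ε => (Baaa.iterD j).map_smul _ _

theorem Maaa.iterD_mem (j : ℕ) {u : Maaa} (hu : u ∈ Naaa) : Maaa.iterD j u ∈ Naaa :=
  fun k m => ((hu (k + j) m).const_mul (C := (k : ℝ) + 1) (by positivity)).mono
    (fun ε => normK_iterD_le k j _) le_rfl

/-- The derivation `[(u_ε)_ε] ↦ [(u_ε^{(j)})_ε]` of `G_aaa`. -/
def Gaaa.iterD (j : ℕ) : Gaaa →ₗ[ℂ] Gaaa where
  toFun := Quotient.map' (Maaa.iterD j) fun u v h => by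
    rw [Submodule.quotientRel_def] at h ⊢
    rw [← map_sub]
    exact Maaa.iterD_mem j h
  map_add' a b := by
    induction a using Quotient.inductionOn'
    induction b using Quotient.inductionOn'
    exact congrArg Gaaa.mk (map_add (Maaa.iterD j) _ _)
  map_smul' c a := by
    induction a using Quotient.inductionOn'
    exact congrArg Gaaa.mk (map_smul (Maaa.iterD j) c _)

theorem Gaaa.iterD_mk (j : ℕ) (u : Maaa) :
    Gaaa.iterD j (Gaaa.mk u) = Gaaa.mk (Maaa.iterD j u) := rfl

/-! ### Bounded distributions -/

/-- The underlying vector space of `D_{L^1}(ℝ)`: smooth functions with all derivatives in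
`L^1`. -/
def DL1sub : Submodule ℂ (ℝ → ℂ) where
  carrier := {φ | ContDiff ℝ ∞ φ ∧ ∀ j : ℕ, Integrable (iteratedDeriv j φ)}
  add_mem' := by
    rintro f g ⟨hf, hf'⟩ ⟨hg, hg'⟩
    refine ⟨hf.add hg, fun j => ?_⟩
    have : iteratedDeriv j (f + g) = iteratedDeriv j f + iteratedDeriv j g :=
      funext fun x => iteratedDeriv_add (contDiffAt_nat hf j x) (contDiffAt_nat hg j x)
    rw [this]
    exact (hf' j).add (hg' j)
  zero_mem' := by
    refine ⟨contDiff_const, fun j => ?_⟩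
    have : iteratedDeriv j (0 : ℝ → ℂ) = 0 := funext fun x => iteratedDeriv_const_zero
    rw [this]
    exact integrable_zero _ _ _
  smul_mem' := by
    rintro c f ⟨hf, hf'⟩
    refine ⟨hf.const_smul c, fun j => ?_⟩
    have : iteratedDeriv j (c • f) = c • iteratedDeriv j f :=
      funext fun x => iteratedDeriv_const_smul_field c f
    rw [this]
    exact (hf' j).smul c

/-- The space `D_{L^1}(ℝ)`. It is a type of its own so that it carries only the topology of its
seminorms, and not the topology of pointwise convergence. -/
def DL1 : Type := DL1sub

namespace DL1

instance : AddCommGroup DL1 := inferInstanceAs (AddCommGroup DL1sub)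
instance : Module ℂ DL1 := inferInstanceAs (Module ℂ DL1sub)
instance : FunLike DL1 ℝ ℂ := ⟨fun φ => Subtype.val (p := (· ∈ DL1sub)) φ,
  Subtype.val_injective⟩

/-- An element of `D_{L^1}` from a function and the proof of its properties. -/
def ofFun (φ : ℝ → ℂ) (h : ContDiff ℝ ∞ φ) (h' : ∀ j : ℕ, Integrable (iteratedDeriv j φ)) :
    DL1 := (⟨φ, h, h'⟩ : DL1sub)

theorem contDiff (φ : DL1) : ContDiff ℝ ∞ φ := φ.2.1

theorem integrable_iteratedDeriv (φ : DL1) (j : ℕ) : Integrable (iteratedDeriv j φ) := φ.2.2 j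

theorem integrable (φ : DL1) : Integrable φ := by
  simpa using φ.integrable_iteratedDeriv 0

@[simp] theorem coe_ofFun (φ : ℝ → ℂ) (h : ContDiff ℝ ∞ φ)
    (h' : ∀ j : ℕ, Integrable (iteratedDeriv j φ)) : (ofFun φ h h' : ℝ → ℂ) = φ := rfl

@[simp] theorem coe_add (φ ψ : DL1) : ((φ + ψ : DL1) : ℝ → ℂ) = (φ : ℝ → ℂ) + ψ := rfl

@[simp] theorem coe_zero : ((0 : DL1) : ℝ → ℂ) = 0 := rfl

@[simp] theorem coe_neg (φ : DL1) : ((-φ : DL1) : ℝ → ℂ) = -(φ : ℝ → ℂ) := rfl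

@[simp] theorem coe_sub (φ ψ : DL1) : ((φ - ψ : DL1) : ℝ → ℂ) = (φ : ℝ → ℂ) - ψ := rfl

@[simp] theorem coe_smul (c : ℂ) (φ : DL1) : ((c • φ : DL1) : ℝ → ℂ) = c • (φ : ℝ → ℂ) := rfl

/-- The `j`-th derivative on `D_{L^1}`, as a linear map. -/
def iterDₗ (j : ℕ) : DL1 →ₗ[ℂ] DL1 where
  toFun φ := ofFun (iteratedDeriv j φ) (contDiff_iteratedDeriv φ.contDiff j) fun i => by
    rw [iteratedDeriv_add_index]
    exact φ.integrable_iteratedDeriv _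
  map_add' f g := DFunLike.ext _ _ fun x =>
    iteratedDeriv_add (contDiffAt_nat f.contDiff j x) (contDiffAt_nat g.contDiff j x)
  map_smul' c f := DFunLike.ext _ _ fun _ => iteratedDeriv_const_smul_field c (f : ℝ → ℂ)

@[simp] theorem coe_iterDₗ (j : ℕ) (φ : DL1) : (iterDₗ j φ : ℝ → ℂ) = iteratedDeriv j φ := rfl

/-- The `L^1` norm, as a seminorm on `D_{L^1}`. -/
def l1 : Seminorm ℂ DL1 :=
  Seminorm.of (fun φ => ∫ x, ‖φ x‖)
    (fun φ ψ => by
      rw [← integral_add φ.integrable.norm ψ.integrable.norm]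
      exact integral_mono (φ + ψ).integrable.norm
        (φ.integrable.norm.add ψ.integrable.norm) fun x => norm_add_le _ _)
    (fun c φ => by
      rw [← integral_const_mul]
      exact integral_congr_ae (Eventually.of_forall fun x => norm_smul c (φ x)))

/-- The seminorms `|φ|_{k,1,ℝ} = ∑_{j ≤ k} ‖φ^{(j)}‖_{L^1(ℝ)}` on `D_{L^1}`. -/
def seminorms : SeminormFamily ℂ DL1 ℕ := fun k =>
  ∑ j ∈ Finset.range (k + 1), l1.comp (iterDₗ j)

theorem seminorms_apply (k : ℕ) (φ : DL1) :
    seminorms k φ = ∑ j ∈ Finset.range (k + 1), ∫ x, ‖iteratedDeriv j φ x‖ := by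
  unfold seminorms
  induction k + 1 with
  | zero => simp
  | succ n ih =>
    rw [Finset.sum_range_succ, Finset.sum_range_succ, add_apply, ih]
    rfl

instance : TopologicalSpace DL1 := seminorms.moduleFilterBasis.topology

theorem withSeminorms : WithSeminorms seminorms := ⟨rfl⟩

theorem seminorms_iterDₗ_le (k j : ℕ) (φ : DL1) :
    seminorms k (iterDₗ j φ) ≤ (k + 1) * seminorms (k + j) φ := by
  rw [seminorms_apply, seminorms_apply]
  have : ∀ i ∈ Finset.range (k + 1), (∫ x, ‖iteratedDeriv i (iterDₗ j φ) x‖) ≤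
      ∑ j ∈ Finset.range (k + j + 1), ∫ x, ‖iteratedDeriv j φ x‖ := by
    intro i hi
    have hi' : i ≤ k := Nat.lt_succ_iff.1 (Finset.mem_range.1 hi)
    rw [coe_iterDₗ, iteratedDeriv_add_index]
    exact Finset.single_le_sum (f := fun j => ∫ x, ‖iteratedDeriv j φ x‖)
      (fun _ _ => integral_nonneg fun _ => norm_nonneg _) (Finset.mem_range.2 (by omega))
  simpa using Finset.sum_le_sum this

/-- The `j`-th derivative on `D_{L^1}`, as a continuous linear map. -/
def iterD (j : ℕ) : DL1 →L[ℂ] DL1 where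
  toLinearMap := iterDₗ j
  cont := by
    refine WithSeminorms.continuous_of_isBounded withSeminorms withSeminorms _
      (Seminorm.IsBounded.of_real fun k => ⟨{k + j}, (k : ℝ) + 1, fun φ => ?_⟩)
    simpa using seminorms_iterDₗ_le k j φ

@[simp] theorem coe_iterD (j : ℕ) (φ : DL1) : (iterD j φ : ℝ → ℂ) = iteratedDeriv j φ := rfl

/-- The function `y ↦ φ (x - y)`, for `φ ∈ D_{L^1}`. -/
def reflect (φ : DL1) (x : ℝ) : DL1 :=
  ofFun (fun y => φ (x - y)) (φ.contDiff.comp (contDiff_const.sub contDiff_id)) fun j => by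
    rw [iteratedDeriv_comp_const_sub]
    exact ((φ.integrable_iteratedDeriv j).comp_sub_left x).smul ((-1 : ℝ) ^ j)

@[simp] theorem coe_reflect (φ : DL1) (x : ℝ) : (φ.reflect x : ℝ → ℂ) = fun y => φ (x - y) := rfl

end DL1

/-- The space `B' = D'_{L^∞}(ℝ)` of bounded distributions: the topological dual of
`D_{L^1}(ℝ)`. -/
abbrev BDual : Type := DL1 →L[ℂ] ℂ

/-- The derivative `T^{(j)}` of a bounded distribution, `⟨T^{(j)}, ψ⟩ = (-1)^j ⟨T, ψ^{(j)}⟩`. -/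
def BDual.iterD (j : ℕ) (T : BDual) : BDual := (-1 : ℂ) ^ j • T.comp (DL1.iterD j)

/-- The convolution `(T * φ)(x) = ⟨T, φ(x - ·)⟩` of `T ∈ B'` and `φ ∈ D_{L^1}`. -/
def BDual.conv (T : BDual) (φ : DL1) (x : ℝ) : ℂ := T (φ.reflect x)

/-- The space `B'_aaa` of asymptotically almost automorphic distributions: those `T ∈ B'` with
`T = ∑_{j ≤ k} f_j^{(j)}` for some `k` and some `f_j ∈ C_aaa`, that is
`⟨T, ψ⟩ = ∑_{j ≤ k} (-1)^j ∫ f_j ψ^{(j)}` for all `ψ ∈ D_{L^1}`. -/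
def BaaaDual : Submodule ℂ BDual where
  carrier := {T | ∃ (k : ℕ) (f : ℕ → ℝ → ℂ), (∀ j, j ≤ k → IsAAA (f j)) ∧
    ∀ ψ : DL1, T ψ = ∑ j ∈ Finset.range (k + 1), (-1 : ℂ) ^ j * ∫ x, f j x * iteratedDeriv j ψ x}
  add_mem' := by
    rintro T S ⟨k, f, hf, hT⟩ ⟨l, g, hg, hS⟩
    have key : ∀ (n p : ℕ) (h : ℕ → ℝ → ℂ) (ψ : DL1), n ≤ p →
        ∑ j ∈ Finset.range (n + 1), (-1 : ℂ) ^ j * ∫ x, h j x * iteratedDeriv j ψ x =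
        ∑ j ∈ Finset.range (p + 1), (-1 : ℂ) ^ j *
          ∫ x, (if j ≤ n then h j x else 0) * iteratedDeriv j ψ x := by
      intro n p h ψ hnp
      rw [← Finset.sum_subset (Finset.range_mono (Nat.succ_le_succ hnp))]
      · refine Finset.sum_congr rfl fun j hj => ?_
        simp [Nat.lt_succ_iff.1 (Finset.mem_range.1 hj)]
      · intro j _ hj
        have : ¬ j ≤ n := fun h => hj (Finset.mem_range.2 (Nat.lt_succ_of_le h))
        simp [this]
    have aaa : ∀ (n : ℕ) (h : ℕ → ℝ → ℂ), (∀ j, j ≤ n → IsAAA (h j)) →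
        ∀ j, IsAAA (fun x => if j ≤ n then h j x else 0) := by
      intro n h hh j
      by_cases hj : j ≤ n
      · simpa [hj] using hh j hj
      · simpa [hj] using IsAAA.const 0
    have int : ∀ (h : ℝ → ℂ), IsAAA h → ∀ (ψ : DL1) (j : ℕ),
        Integrable fun x => h x * iteratedDeriv j ψ x := by
      intro h hh ψ j
      obtain ⟨C, hC⟩ := hh.1.2
      exact (ψ.integrable_iteratedDeriv j).bdd_mul hh.1.1.aestronglyMeasurable (Eventually.of_forall hC)
    refine ⟨max k l, fun j x => (if j ≤ k then f j x else 0) + (if j ≤ l then g j x else 0),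
      fun j _ => (aaa k f hf j).add (aaa l g hg j), fun ψ => ?_⟩
    change T ψ + S ψ = _
    rw [hT, hS, key k _ f ψ (le_max_left k l), key l _ g ψ (le_max_right k l),
      ← Finset.sum_add_distrib]
    refine Finset.sum_congr rfl fun j _ => ?_
    rw [← mul_add, ← integral_add (int _ (aaa k f hf j) ψ j) (int _ (aaa l g hg j) ψ j)]
    simp only [add_mul]
  zero_mem' := ⟨0, fun _ _ => 0, fun _ _ => IsAAA.const 0, fun ψ => by simp⟩
  smul_mem' := by
    rintro c T ⟨k, f, hf, hT⟩
    refine ⟨k, fun j x => c * f j x, fun j hj => (IsAAA.const c).mul (hf j hj), fun ψ => ?_⟩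
    change c * T ψ = _
    rw [hT, Finset.mul_sum]
    refine Finset.sum_congr rfl fun j _ => ?_
    simp only [mul_assoc]
    rw [integral_const_mul]
    ring

/-- The derivative `T ↦ T^{(j)}` maps `B'_aaa` to itself. -/
def BaaaDual.iterD (j : ℕ) (T : BaaaDual) : BaaaDual :=
  ⟨BDual.iterD j T, by
    obtain ⟨k, f, hf, hT⟩ := T.2
    refine ⟨j + k, fun i x => if j ≤ i then f (i - j) x else 0, fun i hi => ?_, fun ψ => ?_⟩
    · by_cases h : j ≤ i
      · simpa [h] using hf (i - j) (by omega)
      · simpa [h] using IsAAA.const 0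
    · change (-1 : ℂ) ^ j * (T : BDual) (DL1.iterD j ψ) = _
      rw [hT, add_assoc j k 1, Finset.sum_range_add _ j (k + 1)]
      have h0 : ∑ i ∈ Finset.range j, (-1 : ℂ) ^ i *
          ∫ x, (if j ≤ i then f (i - j) x else 0) * iteratedDeriv i ψ x = 0 := by
        refine Finset.sum_eq_zero fun i hi => ?_
        simp [not_le.2 (Finset.mem_range.1 hi)]
      beta_reduce
      rw [h0, zero_add, Finset.mul_sum]
      refine Finset.sum_congr rfl fun i _ => ?_
      have h1 : iteratedDeriv i (DL1.iterD j ψ : ℝ → ℂ) = iteratedDeriv (j + i) ψ := by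
        rw [DL1.coe_iterD, iteratedDeriv_add_index, add_comm]
      simp only [h1, le_add_iff_nonneg_right, zero_le, if_true, add_tsub_cancel_left, pow_add,
        mul_assoc]⟩

/-- The mollifier `ρ_ε = ε⁻¹ ρ(· / ε)`, an element of `D_{L^1}`. -/
def mollifier (ρ : 𝓢(ℝ, ℂ)) (ε : I) : DL1 :=
  DL1.ofFun (fun x => ((ε : ℝ) : ℂ)⁻¹ * ρ (x / ε))
    (contDiff_const.mul ((ρ.smooth ⊤).comp (contDiff_id.div_const _))) fun j => by
    have hρ : ContDiff ℝ ∞ (ρ : ℝ → ℂ) := ρ.smooth ⊤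
    have h1 : iteratedDeriv j (fun x : ℝ => ((ε : ℝ) : ℂ)⁻¹ * ρ (x / ε)) =
        fun x => ((ε : ℝ) : ℂ)⁻¹ * ((ε : ℝ)⁻¹ ^ j • iteratedDeriv j ρ ((ε : ℝ)⁻¹ * x)) := by
      funext x
      have h2 := iteratedDeriv_comp_const_smul (n := j) (f := (ρ : ℝ → ℂ))
        (hρ.of_le (by exact_mod_cast le_top)) (ε : ℝ)⁻¹
      rw [iteratedDeriv_const_mul_field]
      simp only [div_eq_inv_mul]
      rw [h2]
    have h3 : Integrable (iteratedDeriv j (ρ : ℝ → ℂ)) := by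
      have h4 := SchwartzMap.integrable_pow_mul_iteratedFDeriv volume ρ 0 j
      simp only [pow_zero, one_mul, norm_iteratedFDeriv_eq_norm_iteratedDeriv] at h4
      exact (integrable_norm_iff
        (contDiff_iteratedDeriv hρ j).continuous.aestronglyMeasurable).1 h4
    rw [h1]
    exact ((h3.comp_mul_left' (inv_ne_zero ε.2.1.ne')).smul ((ε : ℝ)⁻¹ ^ j)).const_mul _

end AAA

end

/-! Everything rests on the convolution of a function of `C_aaa` with an integrable function. By
dominated convergence it stays in `C_aaa` (`IsAAA.cconv`), and it can be differentiated by
differentiating the integrable factor (`hasDerivAt_cconv`). If `T = ∑ f_j^{(j)}`, then `T * φ = ∑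
f_j * φ^{(j)}` (`BDual.conv_eq_sum`), so `T * φ` lies in `B_aaa` and `T^{(j)} * φ = T * φ^{(j)} = (T
* φ)^{(j)}`. The scaling `‖ρ_ε^{(j)}‖₁ = ε^{-j} ‖ρ^{(j)}‖₁` then makes `(T * ρ_ε)_ε` moderate.

The diagram commutes because the moments of `ρ` of positive order vanish. In `f * ρ_ε - f` the
Taylor polynomial of `f` contributes only its constant term, which cancels, and the remainder is
`O(ε^m)` uniformly in `x` for every `m` (`exists_norm_cconv_mollifier_sub_le`). The same estimate
holds for each `f^{(j)}`, so the difference is null.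

For injectivity, a null family tends to `0` uniformly. A constant null family is therefore `0`,
which settles `σ`. Since `T * ρ_ε → T` weakly (`tendsto_integral_conv_mollifier_mul`), a null
regularization forces `T = 0`, which settles `ι`. Injectivity of `γ` follows from `ι ∘ γ = σ`. -/

noncomputable section

namespace AAA

/-! ### Convolution of a bounded continuous function and an integrable function -/

/-- The convolution `(f * φ)(x) = ∫ f (x - y) φ y dy`. -/
def cconv (f φ : ℝ → ℂ) (x : ℝ) : ℂ := ∫ y, f (x - y) * φ y

theorem cconv_eq (f φ : ℝ → ℂ) (x : ℝ) : cconv f φ x = ∫ y, f y * φ (x - y) := by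
  rw [← integral_sub_left_eq_self _ volume x]
  simp [cconv]

theorem IsBddCont.mul_integrable {f φ : ℝ → ℂ} (hf : IsBddCont f) (hφ : Integrable φ) :
    Integrable fun y => f y * φ y := by
  obtain ⟨C, hC⟩ := hf.2
  exact hφ.bdd_mul hf.1.aestronglyMeasurable (Eventually.of_forall hC)

theorem IsBddCont.comp_sub_left {f : ℝ → ℂ} (hf : IsBddCont f) (x : ℝ) :
    IsBddCont fun y => f (x - y) :=
  ⟨hf.1.comp (by fun_prop), hf.2.imp fun _ hC _ => hC _⟩

theorem IsBddCont.comp_sub_right {f : ℝ → ℂ} (hf : IsBddCont f) (x : ℝ) :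
    IsBddCont fun y => f (y - x) :=
  ⟨hf.1.comp (by fun_prop), hf.2.imp fun _ hC _ => hC _⟩

theorem norm_integral_mul_le {f φ : ℝ → ℂ} {C : ℝ} (hC : ∀ x, ‖f x‖ ≤ C) (hφ : Integrable φ) :
    ‖∫ y, f y * φ y‖ ≤ C * ∫ y, ‖φ y‖ := by
  rw [← integral_const_mul]
  refine norm_integral_le_of_norm_le (hφ.norm.const_mul C) (Eventually.of_forall fun y => ?_)
  rw [norm_mul]
  exact mul_le_mul_of_nonneg_right (hC y) (norm_nonneg _)

theorem norm_cconv_le {f φ : ℝ → ℂ} {C : ℝ} (hC : ∀ x, ‖f x‖ ≤ C) (hφ : Integrable φ) (x : ℝ) :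
    ‖cconv f φ x‖ ≤ C * ∫ y, ‖φ y‖ :=
  norm_integral_mul_le (fun _ => hC _) hφ

/-- Dominated convergence with majorant `C * ‖φ‖`. This single form serves for continuity,
translation limits, decay at infinity and mollification. -/
theorem tendsto_integral_mul {α : Type*} {l : Filter α} [l.IsCountablyGenerated]
    {F : α → ℝ → ℂ} {G φ : ℝ → ℂ} {C : ℝ}
    (hm : ∀ a, AEStronglyMeasurable (F a)) (hC : ∀ a y, ‖F a y‖ ≤ C) (hφ : Integrable φ)
    (hl : ∀ y, Tendsto (fun a => F a y) l (𝓝 (G y))) :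
    Tendsto (fun a => ∫ y, F a y * φ y) l (𝓝 (∫ y, G y * φ y)) := by
  refine tendsto_integral_filter_of_dominated_convergence (fun y => C * ‖φ y‖)
    (Eventually.of_forall fun a => (hm a).mul hφ.aestronglyMeasurable)
    (Eventually.of_forall fun a => Eventually.of_forall fun y => ?_) (hφ.norm.const_mul C)
    (Eventually.of_forall fun y => (hl y).mul_const _)
  rw [norm_mul]
  exact mul_le_mul_of_nonneg_right (hC a y) (norm_nonneg _)

theorem IsBddCont.cconv {f φ : ℝ → ℂ} (hf : IsBddCont f) (hφ : Integrable φ) :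
    IsBddCont (cconv f φ) := by
  obtain ⟨C, hC⟩ := hf.2
  refine ⟨continuous_iff_continuousAt.2 fun x => ?_, _, norm_cconv_le hC hφ⟩
  exact tendsto_integral_mul (fun a => (hf.comp_sub_left a).1.aestronglyMeasurable)
    (fun _ _ => hC _) hφ fun y => (hf.comp_sub_right y).1.tendsto x

/-- Convolution commutes with translations, so a subsequence that works for `g` works for `g * φ`,
with limit function `g' * φ`. -/
theorem IsAlmostAutomorphic.cconv {g φ : ℝ → ℂ} (hg : IsAlmostAutomorphic g)
    (hφ : Integrable φ) : IsAlmostAutomorphic (cconv g φ) := by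
  refine ⟨(hg.isBddCont.cconv hφ).1, fun s => ?_⟩
  obtain ⟨C, hC⟩ := hg.isBddCont.2
  obtain ⟨n, hn, g', h1, h2⟩ := hg.2 s
  have hC' : ∀ x, ‖g' x‖ ≤ C := fun x =>
    le_of_tendsto (h1 x).norm (Eventually.of_forall fun k => hC _)
  -- `g'` need not be continuous; being a pointwise limit of continuous functions, it is still
  -- measurable, which is enough for the way back.
  have hm : StronglyMeasurable g' := stronglyMeasurable_of_tendsto atTop
    (fun k => (hg.1.comp (continuous_add_const (s (n k)))).stronglyMeasurable)
    (tendsto_pi_nhds.2 h1)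
  refine ⟨n, hn, AAA.cconv g' φ, fun x => ?_, fun x => ?_⟩
  · refine tendsto_integral_mul (fun k => (hg.isBddCont.comp_sub_left _).1.aestronglyMeasurable)
      (fun _ _ => hC _) hφ fun y => ?_
    simpa only [add_sub_right_comm] using h1 (x - y)
  · refine tendsto_integral_mul (fun k =>
      (hm.comp_measurable (measurable_const_sub _)).aestronglyMeasurable)
      (fun _ _ => hC' _) hφ fun y => ?_
    simpa only [sub_right_comm] using h2 (x - y)

theorem VanishesAtPosInfty.cconv {h φ : ℝ → ℂ} (hh : VanishesAtPosInfty h)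
    (hφ : Integrable φ) : VanishesAtPosInfty (cconv h φ) := by
  refine ⟨hh.1.cconv hφ, ?_⟩
  obtain ⟨C, hC⟩ := hh.1.2
  have := tendsto_integral_mul (l := atTop) (F := fun x y => h (x - y)) (G := fun _ => 0)
    (fun a => (hh.1.comp_sub_left a).1.aestronglyMeasurable) (fun _ _ => hC _) hφ
    fun y => hh.2.comp (tendsto_atTop_add_const_right _ (-y) tendsto_id)
  simp only [zero_mul, integral_zero] at this
  exact this

/-- Replacing `h` by `f - g` changes nothing on `[0, +∞[` and extends the decomposition to all of
`ℝ`. The convolution needs this, since `f (x - y)` is evaluated at negative points even when `x ≥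
0`. -/
theorem IsAAA.exists_eq_add {f : ℝ → ℂ} (hf : IsAAA f) : ∃ g h : ℝ → ℂ,
    IsAlmostAutomorphic g ∧ VanishesAtPosInfty h ∧ ∀ x, f x = g x + h x := by
  obtain ⟨hb, g, h, hg, hh, e⟩ := hf
  refine ⟨g, fun x => f x - g x, hg, ⟨?_, ?_⟩, fun x => by ring⟩
  · simpa [sub_eq_add_neg] using hb.add ((IsBddCont.const (-1)).mul hg.isBddCont)
  · refine hh.2.congr' ((eventually_ge_atTop 0).mono fun x hx => ?_)
    simp [e x hx]

theorem IsAAA.cconv {f φ : ℝ → ℂ} (hf : IsAAA f) (hφ : Integrable φ) : IsAAA (cconv f φ) := by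
  obtain ⟨g, h, hg, hh, e⟩ := hf.exists_eq_add
  refine ⟨hf.1.cconv hφ, AAA.cconv g φ, AAA.cconv h φ, hg.cconv hφ, hh.cconv hφ, fun x _ => ?_⟩
  unfold AAA.cconv
  rw [← integral_add ((hg.isBddCont.comp_sub_left x).mul_integrable hφ)
    ((hh.1.comp_sub_left x).mul_integrable hφ)]
  simp only [e, add_mul]

/-- Fubini and the fundamental theorem of calculus applied to `t ↦ φ (t - y)`. Differentiating under
the integral directly would need an integrable majorant for nearby translates of `φ'`, which mere
integrability of `φ'` does not provide. -/
theorem cconv_sub_cconv_zero {f φ : ℝ → ℂ} (hf : IsBddCont f) (hφ : ContDiff ℝ 1 φ)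
    (hi : Integrable φ) (hi' : Integrable (deriv φ)) (x : ℝ) :
    cconv f φ x - cconv f φ 0 = ∫ t in (0 : ℝ)..x, cconv f (deriv φ) t := by
  obtain ⟨C, hC⟩ := hf.2
  have hd : Continuous (deriv φ) := hφ.continuous_deriv le_rfl
  have hint : Integrable (Function.uncurry fun t y : ℝ => f y * deriv φ (t - y))
      ((volume.restrict (Set.uIoc 0 x)).prod volume) := by
    have h1 : Integrable (fun p : ℝ × ℝ => deriv φ (p.1 - p.2))
        ((volume.restrict (Set.uIoc 0 x)).prod volume) := by
      refine (integrable_prod_iff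
        (hd.comp (continuous_fst.sub continuous_snd)).aestronglyMeasurable).2
        ⟨Eventually.of_forall fun t => hi'.comp_sub_left t, ?_⟩
      have : IsFiniteMeasure (volume.restrict (Set.uIoc 0 x)) := by
        unfold Set.uIoc
        infer_instance
      -- By translation invariance the inner `L^1` norm does not depend on `t`, and the interval has
      -- finite measure.
      exact (integrable_const (∫ y, ‖deriv φ y‖)).congr (Eventually.of_forall fun t =>
        (integral_sub_left_eq_self (fun y => ‖deriv φ y‖) volume t).symm)
    exact h1.bdd_mul (hf.1.comp continuous_snd).aestronglyMeasurable
      (Eventually.of_forall fun p => hC p.2)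
  simp only [cconv_eq]
  rw [intervalIntegral_integral_swap hint,
    ← integral_sub (hf.mul_integrable (hi.comp_sub_left x))
      (hf.mul_integrable (hi.comp_sub_left 0))]
  congr 1 with y
  rw [intervalIntegral.integral_const_mul, ← mul_sub,
    intervalIntegral.integral_eq_sub_of_hasDerivAt (f := fun t => φ (t - y))
      (fun t _ => ((hφ.differentiable one_ne_zero) (t - y)).hasDerivAt.comp_sub_const t y)
      ((hd.comp (continuous_sub_right y)).intervalIntegrable _ _)]

/-- The integrated formula can be differentiated because `f * φ'` is continuous. -/
theorem hasDerivAt_cconv {f φ : ℝ → ℂ} (hf : IsBddCont f) (hφ : ContDiff ℝ 1 φ)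
    (hi : Integrable φ) (hi' : Integrable (deriv φ)) (x : ℝ) :
    HasDerivAt (cconv f φ) (cconv f (deriv φ) x) x := by
  have hc : Continuous (cconv f (deriv φ)) := (hf.cconv hi').1
  have h := (intervalIntegral.integral_hasDerivAt_right (hc.intervalIntegrable 0 x)
    (hc.stronglyMeasurableAtFilter _ _) hc.continuousAt).const_add (cconv f φ 0)
  refine h.congr_of_eventuallyEq (Eventually.of_forall fun y => ?_)
  simp only [← cconv_sub_cconv_zero hf hφ hi hi' y, add_sub_cancel]

/-! ### Integration by parts and the Taylor formula -/

/-- Bounded times integrable is integrable, so every product in the integration by parts is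
integrable and no boundary term survives. The induction varies `ψ`, each step replacing it by `ψ'`.
-/
theorem integral_iteratedDeriv_mul {F : ℝ → ℂ} (hF : ContDiff ℝ ∞ F)
    (hb : ∀ j, IsBddCont (iteratedDeriv j F)) (j : ℕ) (ψ : DL1) :
    ∫ x, iteratedDeriv j F x * ψ x = (-1) ^ j * ∫ x, F x * iteratedDeriv j ψ x := by
  induction j generalizing ψ with
  | zero => simp
  | succ j ih =>
    have hd : ∀ {g : ℝ → ℂ} (_ : ContDiff ℝ ∞ g) (i : ℕ) (x : ℝ),
        HasDerivAt (iteratedDeriv i g) (iteratedDeriv (i + 1) g x) x := fun hg i x => by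
      rw [iteratedDeriv_succ]
      exact ((contDiff_iteratedDeriv hg i).differentiable (by simp) x).hasDerivAt
    have h := integral_mul_deriv_eq_deriv_mul_of_integrable (u := iteratedDeriv j F)
      (v := ψ) (v' := iteratedDeriv 1 ψ) (fun x _ => hd hF j x)
      (fun x _ => by simpa using hd ψ.contDiff 0 x)
      ((hb j).mul_integrable (ψ.integrable_iteratedDeriv 1))
      ((hb (j + 1)).mul_integrable ψ.integrable) ((hb j).mul_integrable ψ.integrable)
    rw [eq_comm, neg_eq_iff_eq_neg] at h
    rw [h, show iteratedDeriv 1 (ψ : ℝ → ℂ) = DL1.iterD 1 ψ from rfl, ih, DL1.coe_iterD,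
      iteratedDeriv_add_index]
    ring

/-- As a function of `h`, the remainder of order `m + 1` vanishes at `0` and its derivative is the
remainder of order `m` of `g'`. The mean value inequality thus gains a factor `|h|` with the same
constant, uniformly in `x`. -/
theorem norm_sub_taylor_le {g : ℝ → ℂ} (hg : ContDiff ℝ ∞ g)
    (hb : ∀ j, IsBddCont (iteratedDeriv j g)) (m : ℕ) : ∃ C, 0 ≤ C ∧ ∀ x h : ℝ,
      ‖g (x + h) - ∑ i ∈ Finset.range m, ((h : ℂ) ^ i / i.factorial) * iteratedDeriv i g x‖
        ≤ C * |h| ^ m := by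
  induction m generalizing g with
  | zero =>
    obtain ⟨C, hC⟩ := (hb 0).2
    refine ⟨C, (norm_nonneg _).trans (hC 0), fun x h => ?_⟩
    simpa using hC (x + h)
  | succ m ih =>
    have h1 : ∀ i, iteratedDeriv i (iteratedDeriv 1 g) = iteratedDeriv (i + 1) g :=
      fun i => iteratedDeriv_add_index i 1 g
    obtain ⟨C, hC0, hC⟩ := ih (contDiff_iteratedDeriv hg 1) fun j => by
      rw [h1]
      exact hb _
    refine ⟨C, hC0, fun x h => ?_⟩
    set R : ℝ → ℂ := fun h => g (x + h) -
      ∑ i ∈ Finset.range (m + 1), ((h : ℂ) ^ i / i.factorial) * iteratedDeriv i g x with hR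
    have hR0 : R 0 = 0 := by simp [hR, Finset.sum_range_succ']
    have hd : ∀ t, HasDerivAt R (iteratedDeriv 1 g (x + t) - ∑ i ∈ Finset.range m,
        ((t : ℂ) ^ i / i.factorial) * iteratedDeriv i (iteratedDeriv 1 g) x) t := by
      intro t
      have e : R = fun h : ℝ => g (x + h) - (∑ i ∈ Finset.range m,
          ((h : ℂ) ^ (i + 1) / (i + 1).factorial) * iteratedDeriv (i + 1) g x + g x) := by
        funext h
        simp [hR, Finset.sum_range_succ']
      rw [e]
      refine HasDerivAt.sub ?_ ((HasDerivAt.fun_sum fun i _ => ?_).add_const _)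
      · rw [iteratedDeriv_one]
        exact ((hg.differentiable (by simp)) (x + t)).hasDerivAt.comp_const_add x t
      · rw [h1]
        refine HasDerivAt.mul_const ?_ _
        have h2 := ((hasDerivAt_id (t : ℂ)).comp_ofReal.pow (i + 1)).div_const
          (((i + 1).factorial : ℕ) : ℂ)
        refine (h2.congr_deriv ?_)
        have : (i.factorial : ℂ) ≠ 0 := by exact_mod_cast i.factorial_ne_zero
        have h3 : (i + 1 : ℂ) ≠ 0 := by exact_mod_cast i.succ_ne_zero
        simp only [Nat.factorial_succ, Nat.cast_mul, Nat.cast_add, Nat.cast_one, id,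
          add_tsub_cancel_right]
        field_simp
    have h4 := (convex_uIcc (0 : ℝ) h).norm_image_sub_le_of_norm_hasDerivWithin_le
      -- Between `0` and `h` one has `|t| ≤ |h|`.
      (C := C * |h| ^ m) (fun t _ => (hd t).hasDerivWithinAt) (fun t ht => (hC x t).trans
        (mul_le_mul_of_nonneg_left (pow_le_pow_left₀ (abs_nonneg _)
          (by simpa using Set.abs_sub_left_of_mem_uIcc ht) _) hC0))
      Set.left_mem_uIcc Set.right_mem_uIcc
    rw [hR0, sub_zero, sub_zero, Real.norm_eq_abs] at h4
    rwa [pow_succ, ← mul_assoc]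

/-! ### Convolution of a distribution and a function of `D_{L^1}` -/

theorem DL1.iteratedDeriv_reflect (φ : DL1) (x : ℝ) (j : ℕ) (y : ℝ) :
    iteratedDeriv j (φ.reflect x) y = (-1) ^ j * iteratedDeriv j φ (x - y) := by
  rw [DL1.coe_reflect, iteratedDeriv_comp_const_sub]
  simp

theorem DL1.iterD_reflect (φ : DL1) (x : ℝ) (j : ℕ) :
    DL1.iterD j (φ.reflect x) = (-1 : ℂ) ^ j • (DL1.iterD j φ).reflect x :=
  DFunLike.ext _ _ fun y => φ.iteratedDeriv_reflect x j y

theorem BDual.conv_iterD (T : BDual) (j : ℕ) (φ : DL1) :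
    (BDual.iterD j T).conv φ = T.conv (DL1.iterD j φ) := by
  funext x
  change (-1 : ℂ) ^ j • T (DL1.iterD j (φ.reflect x)) = T ((DL1.iterD j φ).reflect x)
  rw [DL1.iterD_reflect, map_smul, smul_smul, ← mul_pow]
  simp

/-- The sign in the distributional derivative cancels the one produced by differentiating `y ↦ φ (x
- y)`. -/
theorem BDual.conv_eq_sum {T : BDual} {k : ℕ} {f : ℕ → ℝ → ℂ}
    (hT : ∀ ψ : DL1, T ψ =
      ∑ j ∈ Finset.range (k + 1), (-1 : ℂ) ^ j * ∫ x, f j x * iteratedDeriv j ψ x) (φ : DL1) :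
    T.conv φ = fun x => ∑ j ∈ Finset.range (k + 1), cconv (f j) (iteratedDeriv j φ) x := by
  funext x
  rw [BDual.conv, hT]
  refine Finset.sum_congr rfl fun j _ => ?_
  rw [cconv_eq, ← integral_const_mul]
  congr 1 with y
  rw [DL1.iteratedDeriv_reflect]
  have : ((-1 : ℂ) ^ j) * (-1) ^ j = 1 := by rw [← mul_pow]; simp
  linear_combination (f j y * iteratedDeriv j φ (x - y)) * this

theorem hasDerivAt_cconv_iteratedDeriv {f : ℝ → ℂ} (hf : IsBddCont f) (φ : DL1) (j : ℕ) (x : ℝ) :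
    HasDerivAt (cconv f (iteratedDeriv j φ)) (cconv f (iteratedDeriv (j + 1) φ) x) x := by
  rw [iteratedDeriv_succ]
  refine hasDerivAt_cconv hf ((contDiff_iteratedDeriv φ.contDiff j).of_le (by simp))
    (φ.integrable_iteratedDeriv j) ?_ x
  rw [← iteratedDeriv_succ]
  exact φ.integrable_iteratedDeriv _

theorem BaaaDual.hasDerivAt_conv (T : BaaaDual) (φ : DL1) (x : ℝ) :
    HasDerivAt ((T : BDual).conv φ) ((T : BDual).conv (DL1.iterD 1 φ) x) x := by
  obtain ⟨k, f, hf, hT⟩ := T.2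
  rw [BDual.conv_eq_sum hT, BDual.conv_eq_sum hT]
  refine HasDerivAt.fun_sum fun j hj => ?_
  rw [DL1.coe_iterD, iteratedDeriv_add_index]
  exact hasDerivAt_cconv_iteratedDeriv
    (hf j (Nat.lt_succ_iff.1 (Finset.mem_range.1 hj))).1 φ j x

theorem BaaaDual.iteratedDeriv_conv (T : BaaaDual) (φ : DL1) (j : ℕ) :
    iteratedDeriv j ((T : BDual).conv φ) = (T : BDual).conv (DL1.iterD j φ) := by
  induction j with
  | zero =>
    rw [iteratedDeriv_zero]
    congr 1
  | succ j ih =>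
    rw [iteratedDeriv_succ, ih]
    funext x
    rw [(BaaaDual.hasDerivAt_conv T _ x).deriv]
    congr 1
    exact DFunLike.ext _ _ fun x => by
      simp only [DL1.coe_iterD, iteratedDeriv_add_index, add_comm 1 j]

theorem BaaaDual.isAAA_conv (T : BaaaDual) (φ : DL1) : IsAAA ((T : BDual).conv φ) := by
  obtain ⟨k, f, hf, hT⟩ := T.2
  rw [BDual.conv_eq_sum hT]
  exact IsAAA.sum _ fun j hj => (hf j (Nat.lt_succ_iff.1 (Finset.mem_range.1 hj))).cconv
    (φ.integrable_iteratedDeriv j)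

/-- The convolution `T * φ`, for `T ∈ B'_aaa` and `φ ∈ D_{L^1}`, as an element of `B_aaa`. -/
def BaaaDual.conv (φ : DL1) : BaaaDual →ₗ[ℂ] Baaa where
  toFun T := ⟨(T : BDual).conv φ, contDiff_of_differentiable_iteratedDeriv fun j _ => by
      rw [BaaaDual.iteratedDeriv_conv T]
      exact fun x => (BaaaDual.hasDerivAt_conv T _ x).differentiableAt,
    fun j => by
      rw [BaaaDual.iteratedDeriv_conv T]
      exact BaaaDual.isAAA_conv T _⟩
  map_add' _ _ := rfl
  map_smul' _ _ := rfl

theorem BaaaDual.coe_conv (φ : DL1) (T : BaaaDual) :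
    (BaaaDual.conv φ T : ℝ → ℂ) = (T : BDual).conv φ := rfl

/-- Both sides equal `T * φ^{(j)}`, so `ι` commutes with derivatives already on representatives. -/
theorem BaaaDual.conv_iterD (φ : DL1) (j : ℕ) (T : BaaaDual) :
    BaaaDual.conv φ (BaaaDual.iterD j T) = Baaa.iterD j (BaaaDual.conv φ T) :=
  Subtype.ext ((BDual.conv_iterD T j φ).trans (BaaaDual.iteratedDeriv_conv T φ j).symm)

/-! ### Mollification -/

theorem integrable_pow_mul_norm_schwartz (ρ : 𝓢(ℝ, ℂ)) (k : ℕ) :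
    Integrable fun x : ℝ => |x| ^ k * ‖ρ x‖ := by
  simpa using SchwartzMap.integrable_pow_mul_iteratedFDeriv volume ρ k 0

theorem mollifier_apply (ρ : 𝓢(ℝ, ℂ)) (ε : I) (x : ℝ) :
    mollifier ρ ε x = ((ε : ℝ) : ℂ)⁻¹ * ρ (x / ε) := rfl

theorem iteratedDeriv_mollifier (ρ : 𝓢(ℝ, ℂ)) (ε : I) (j : ℕ) (x : ℝ) :
    iteratedDeriv j (mollifier ρ ε) x =
      (((ε : ℝ) : ℂ) ^ (j + 1))⁻¹ * iteratedDeriv j ρ (x / ε) := by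
  change iteratedDeriv j (fun x : ℝ => ((ε : ℝ) : ℂ)⁻¹ * ρ (x / ε)) x = _
  have h2 := iteratedDeriv_comp_const_smul (n := j) (f := (ρ : ℝ → ℂ))
    ((ρ.smooth ⊤).of_le (by exact_mod_cast le_top)) (ε : ℝ)⁻¹
  rw [iteratedDeriv_const_mul_field]
  simp only [div_eq_inv_mul]
  rw [h2]
  simp only [Complex.real_smul, ← mul_assoc]
  push_cast
  ring

/-- Of the `j + 1` factors `ε⁻¹` in `ρ_ε^{(j)}`, one is absorbed by the change of variables. For `j
= 0` the norm is independent of `ε`. -/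
theorem integral_norm_iteratedDeriv_mollifier (ρ : 𝓢(ℝ, ℂ)) (ε : I) (j : ℕ) :
    ∫ x, ‖iteratedDeriv j (mollifier ρ ε) x‖ =
      ((ε : ℝ) ^ j)⁻¹ * ∫ x, ‖iteratedDeriv j ρ x‖ := by
  have hε : 0 < (ε : ℝ) := ε.2.1
  simp only [iteratedDeriv_mollifier, norm_mul, norm_inv, norm_pow, Complex.norm_real,
    Real.norm_of_nonneg hε.le]
  rw [integral_const_mul, Measure.integral_comp_div (fun x => ‖iteratedDeriv j ρ x‖),
    abs_of_pos hε, smul_eq_mul, ← mul_assoc]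
  congr 1
  field_simp
  ring

/-- The mollification of `f` in terms of the unscaled mollifier. -/
theorem cconv_mollifier (ρ : 𝓢(ℝ, ℂ)) (ε : I) (f : ℝ → ℂ) (x : ℝ) :
    cconv f (mollifier ρ ε) x = ∫ z : ℝ, f (x - ε * z) * ρ z := by
  have hε : (ε : ℝ) ≠ 0 := ε.2.1.ne'
  have h := Measure.integral_comp_div (fun z : ℝ => f (x - ε * z) * ρ z) (ε : ℝ)
  simp only [mul_div_cancel₀ _ hε, abs_of_pos ε.2.1] at h
  rw [← inv_smul_eq_iff₀ hε, ← integral_smul] at h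
  rw [← h, cconv]
  congr 1 with y
  rw [mollifier_apply, Complex.real_smul]
  push_cast
  ring

theorem isModerate_conv_mollifier (ρ : 𝓢(ℝ, ℂ)) (T : BaaaDual) :
    IsModerate fun ε => BaaaDual.conv (mollifier ρ ε) T := by
  obtain ⟨k, f, hf, hT⟩ := T.2
  intro K
  choose! C hC using fun j (hj : j ≤ k) => (hf j hj).1.2
  set A : ℝ := ∑ i ∈ Finset.range (K + 1), ∑ j ∈ Finset.range (k + 1),
    |C j| * ∫ x, ‖iteratedDeriv (j + i) ρ x‖ with hA
  -- The exponent adds the order `k` of `T` to the number `K` of derivatives taken. The `+ 1` only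
  -- makes the constant positive, and the bound holds on all of `I`.
  refine ⟨k + K, |A| + 1, by positivity, ⟨1, by norm_num⟩, fun ε _ => ?_⟩
  have hε : 0 < (ε : ℝ) := ε.2.1
  have h1 : (ε : ℝ) ^ (-((k + K : ℕ) : ℤ)) = ((ε : ℝ) ^ (k + K))⁻¹ := by
    rw [zpow_neg, zpow_natCast]
  have h2 : normK K (BaaaDual.conv (mollifier ρ ε) T) ≤ A * ((ε : ℝ) ^ (k + K))⁻¹ := by
    rw [hA, Finset.sum_mul]
    refine Finset.sum_le_sum fun i hi => supNorm_le fun x => ?_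
    rw [BaaaDual.coe_conv, BaaaDual.iteratedDeriv_conv T, BDual.conv_eq_sum hT, Finset.sum_mul]
    refine (norm_sum_le _ _).trans (Finset.sum_le_sum fun j hj => ?_)
    have hi' := Nat.lt_succ_iff.1 (Finset.mem_range.1 hi)
    have hj' := Nat.lt_succ_iff.1 (Finset.mem_range.1 hj)
    rw [DL1.coe_iterD, iteratedDeriv_add_index, mul_assoc]
    refine (norm_cconv_le (fun x => (hC j hj' x).trans (le_abs_self _))
      ((mollifier ρ ε).integrable_iteratedDeriv _) x).trans
      (mul_le_mul_of_nonneg_left ?_ (abs_nonneg _))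
    rw [integral_norm_iteratedDeriv_mollifier, mul_comm]
    refine mul_le_mul_of_nonneg_left ?_ (integral_nonneg fun _ => norm_nonneg _)
    exact inv_anti₀ (by positivity) (pow_le_pow_of_le_one hε.le ε.2.2 (by omega))
  rw [h1]
  exact h2.trans (mul_le_mul_of_nonneg_right ((le_abs_self A).trans (by linarith))
    (by positivity))

theorem iteratedDeriv_cconv {f : ℝ → ℂ} (hf : IsBddCont f) (φ : DL1) (j : ℕ) :
    iteratedDeriv j (cconv f φ) = cconv f (iteratedDeriv j φ) := by
  induction j with
  | zero => simp
  | succ j ih =>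
    rw [iteratedDeriv_succ, ih]
    exact funext fun x => (hasDerivAt_cconv_iteratedDeriv hf φ j x).deriv

theorem contDiff_cconv {f : ℝ → ℂ} (hf : IsBddCont f) (φ : DL1) : ContDiff ℝ ∞ (cconv f φ) :=
  contDiff_of_differentiable_iteratedDeriv fun j _ => by
    rw [iteratedDeriv_cconv hf]
    exact fun x => (hasDerivAt_cconv_iteratedDeriv hf φ j x).differentiableAt

/-- Integration by parts in `y`. It lets the mollification error of `f^{(j)}` control the `j`-th
derivative of that of `f`. -/
theorem cconv_iteratedDeriv_left (f : Baaa) (φ : DL1) (j : ℕ) :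
    cconv (iteratedDeriv j (f : ℝ → ℂ)) φ = cconv f (iteratedDeriv j φ) := by
  funext x
  have h1 : ∀ i, iteratedDeriv i (fun y => (f : ℝ → ℂ) (x - y)) =
      fun y => (-1) ^ i * iteratedDeriv i (f : ℝ → ℂ) (x - y) := fun i => by
    rw [iteratedDeriv_comp_const_sub]
    funext y
    simp
  have h := integral_iteratedDeriv_mul (F := fun y => (f : ℝ → ℂ) (x - y))
    (f.2.1.comp (contDiff_const.sub contDiff_id))
    (fun i => by
      rw [h1]
      exact (IsBddCont.const _).mul ((f.2.2 i).1.comp_sub_left x)) j φ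
  simp only [h1, mul_assoc] at h
  rw [integral_const_mul] at h
  exact mul_left_cancel₀ (pow_ne_zero j (by simp)) h

/-! ### Convergence of mollifications -/

theorem tendsto_cconv_mollifier {ρ : 𝓢(ℝ, ℂ)} (hρ : ∫ x, ρ x = 1) {f : ℝ → ℂ} (hf : IsBddCont f)
    {ε : ℕ → I} (hε : Tendsto (fun n => (ε n : ℝ)) atTop (𝓝 0)) (x : ℝ) :
    Tendsto (fun n => cconv f (mollifier ρ (ε n)) x) atTop (𝓝 (f x)) := by
  obtain ⟨C, hC⟩ := hf.2
  simp only [cconv_mollifier]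
  have h := tendsto_integral_mul (F := fun n z => f (x - ε n * z)) (G := fun _ => f x)
    (φ := ρ) (l := atTop) (C := C)
    (fun n => (hf.1.comp (by fun_prop)).aestronglyMeasurable) (fun _ _ => hC _) ρ.integrable
    fun z => (hf.1.tendsto x).comp (by simpa using (hε.mul_const z).const_sub x)
  rwa [integral_const_mul, hρ, mul_one] at h

/-- Moving the derivatives onto `ψ` leaves the mollifications `f_j * ρ_ε`, which converge pointwise
to `f_j`. They are bounded uniformly in `ε` because `‖ρ_ε‖₁ = ‖ρ‖₁`. -/
theorem tendsto_integral_conv_mollifier_mul {ρ : 𝓢(ℝ, ℂ)} (hρ : ∫ x, ρ x = 1) (T : BaaaDual)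
    {ε : ℕ → I} (hε : Tendsto (fun n => (ε n : ℝ)) atTop (𝓝 0)) (ψ : DL1) :
    Tendsto (fun n => ∫ x, (T : BDual).conv (mollifier ρ (ε n)) x * ψ x) atTop
      (𝓝 ((T : BDual) ψ)) := by
  obtain ⟨k, f, hf, hT⟩ := T.2
  have hb : ∀ j ∈ Finset.range (k + 1), IsBddCont (f j) := fun j hj =>
    (hf j (Nat.lt_succ_iff.1 (Finset.mem_range.1 hj))).1
  have h1 : ∀ φ : DL1, ∫ x, (T : BDual).conv φ x * ψ x =
      ∑ j ∈ Finset.range (k + 1), (-1) ^ j * ∫ x, cconv (f j) φ x * iteratedDeriv j ψ x := by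
    intro φ
    rw [BDual.conv_eq_sum hT]
    simp only [Finset.sum_mul]
    rw [integral_finsetSum _ fun j hj => ((hb j hj).cconv
      (φ.integrable_iteratedDeriv j)).mul_integrable ψ.integrable]
    refine Finset.sum_congr rfl fun j hj => ?_
    rw [← iteratedDeriv_cconv (hb j hj), integral_iteratedDeriv_mul (contDiff_cconv (hb j hj) φ)]
    intro i
    rw [iteratedDeriv_cconv (hb j hj)]
    exact (hb j hj).cconv (φ.integrable_iteratedDeriv i)
  simp only [h1]
  rw [hT]
  refine tendsto_finsetSum _ fun j hj => Tendsto.const_mul _ ?_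
  obtain ⟨C, hC⟩ := (hb j hj).2
  refine tendsto_integral_mul (C := C * ∫ x, ‖ρ x‖)
    (fun n => ((hb j hj).cconv (mollifier ρ (ε n)).integrable).1.aestronglyMeasurable)
    (fun n y => ?_) (ψ.integrable_iteratedDeriv j) (tendsto_cconv_mollifier hρ (hb j hj) hε)
  have h2 := integral_norm_iteratedDeriv_mollifier ρ (ε n) 0
  simp only [iteratedDeriv_zero, pow_zero, inv_one, one_mul] at h2
  rw [← h2]
  exact norm_cconv_le hC (mollifier ρ (ε n)).integrable y

/-- Taylor expansion of `g (x - ε z)` under the integral against `ρ z`: the moment conditions reduce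
the polynomial to `g x`, and the remainder is at most a constant times `ε ^ (m + 1) * |z| ^ (m +
1)`, integrable against the Schwartz function `ρ`. -/
theorem exists_norm_cconv_mollifier_sub_le {ρ : 𝓢(ℝ, ℂ)} (hρ : ∫ x, ρ x = 1)
    (hρ' : ∀ k : ℕ, 1 ≤ k → ∫ x : ℝ, (x : ℂ) ^ k * ρ x = 0) {g : ℝ → ℂ} (hg : ContDiff ℝ ∞ g)
    (hb : ∀ j, IsBddCont (iteratedDeriv j g)) (m : ℕ) : ∃ C, 0 ≤ C ∧ ∀ (ε : I) (x : ℝ),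
      ‖cconv g (mollifier ρ ε) x - g x‖ ≤ C * (ε : ℝ) ^ (m + 1) := by
  -- Order `m + 1` ensures that the Taylor sum contains its constant term `g x`.
  obtain ⟨C, hC0, hC⟩ := norm_sub_taylor_le hg hb (m + 1)
  refine ⟨C * ∫ z : ℝ, |z| ^ (m + 1) * ‖ρ z‖,
    mul_nonneg hC0 (integral_nonneg fun _ => by positivity), fun ε x => ?_⟩
  have hb0 : IsBddCont g := by simpa using hb 0
  -- The coefficient of `z ^ i` in the Taylor polynomial with increment `-ε z`.
  set c : ℕ → ℂ := fun i => (-(ε : ℝ) : ℂ) ^ i / i.factorial * iteratedDeriv i g x with hc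
  have hmom : ∀ i : ℕ, Integrable fun z : ℝ => (z : ℂ) ^ i * ρ z := fun i => by
    refine (integrable_norm_iff ?_).1 ?_
    · exact (Continuous.mul (by fun_prop) ρ.continuous).aestronglyMeasurable
    · simpa using integrable_pow_mul_norm_schwartz ρ i
  have hP : ∫ z : ℝ, ∑ i ∈ Finset.range (m + 1), c i * ((z : ℂ) ^ i * ρ z) = g x := by
    rw [integral_finsetSum _ fun i _ => (hmom i).const_mul _, Finset.sum_range_succ']
    simp only [integral_const_mul]
    rw [Finset.sum_eq_zero fun i _ => by rw [hρ' (i + 1) (by omega), mul_zero]]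
    simp [hc, hρ]
  have hint : Integrable fun z : ℝ => g (x - ε * z) * ρ z :=
    IsBddCont.mul_integrable ⟨hb0.1.comp (by fun_prop), hb0.2.imp fun _ h _ => h _⟩ ρ.integrable
  rw [cconv_mollifier, ← hP, ← integral_sub hint
    (integrable_finsetSum _ fun i _ => (hmom i).const_mul _)]
  have hr : C * (∫ z : ℝ, |z| ^ (m + 1) * ‖ρ z‖) * (ε : ℝ) ^ (m + 1) =
      ∫ z : ℝ, (C * (ε : ℝ) ^ (m + 1)) * (|z| ^ (m + 1) * ‖ρ z‖) := by
    rw [integral_const_mul]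
    ring
  rw [hr]
  refine norm_integral_le_of_norm_le ((integrable_pow_mul_norm_schwartz ρ _).const_mul _)
    (Eventually.of_forall fun z => ?_)
  have h1 := hC x (-(ε * z))
  rw [abs_neg, abs_mul, abs_of_pos ε.2.1, mul_pow, ← sub_eq_add_neg] at h1
  have h2 : g (x - ε * z) * ρ z - ∑ i ∈ Finset.range (m + 1), c i * ((z : ℂ) ^ i * ρ z) =
      (g (x - ε * z) - ∑ i ∈ Finset.range (m + 1),
        (((-(ε * z) : ℝ) : ℂ) ^ i / i.factorial) * iteratedDeriv i g x) * ρ z := by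
    rw [sub_mul, Finset.sum_mul]
    congr 1
    refine Finset.sum_congr rfl fun i _ => ?_
    rw [Complex.ofReal_neg, Complex.ofReal_mul, ← neg_mul, mul_pow]
    simp only [hc]
    ring
  rw [h2, norm_mul]
  calc _ ≤ C * ((ε : ℝ) ^ (m + 1) * |z| ^ (m + 1)) * ‖ρ z‖ :=
        mul_le_mul_of_nonneg_right h1 (norm_nonneg _)
    _ = _ := by ring

/-! ### The three embeddings -/

/-- The linear functional `ψ ↦ ∫ f ψ` on `D_{L^1}`, for a bounded continuous function `f`. -/
def DL1.integralMul (f : ℝ → ℂ) (hf : IsBddCont f) : DL1 →ₗ[ℂ] ℂ where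
  toFun ψ := ∫ x, f x * ψ x
  map_add' φ ψ := by
    rw [← integral_add (hf.mul_integrable φ.integrable) (hf.mul_integrable ψ.integrable)]
    simp [mul_add]
  map_smul' c ψ := by
    rw [RingHom.id_apply, smul_eq_mul, ← integral_const_mul]
    simp [mul_left_comm]

/-- A bounded continuous function as a bounded distribution. -/
def BDual.ofBddCont (f : ℝ → ℂ) (hf : IsBddCont f) : BDual where
  toLinearMap := DL1.integralMul f hf
  cont := by
    refine WithSeminorms.continuous_normedSpace_rng (𝕝₂ := ℂ) ℂ DL1.withSeminorms
      (DL1.integralMul f hf) ⟨{0}, (supNorm f).toNNReal, fun ψ => ?_⟩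
    simp only [Finset.sup_singleton, Seminorm.comp_apply, coe_normSeminorm]
    change ‖∫ x, f x * ψ x‖ ≤ ((supNorm f).toNNReal : ℝ) * DL1.seminorms 0 ψ
    rw [Real.coe_toNNReal _ (supNorm_nonneg f), DL1.seminorms_apply]
    simpa using norm_integral_mul_le (le_supNorm hf) ψ.integrable

/-- The embedding `γ_aaa : B_aaa → B'_aaa`. -/
def Baaa.toDual : Baaa →ₗ[ℂ] BaaaDual where
  toFun f := ⟨BDual.ofBddCont f (by simpa using (f.2.2 0).1), 0, fun _ => f,
    fun _ _ => by simpa using f.2.2 0, fun ψ => by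
      simp only [zero_add, Finset.sum_range_one, pow_zero, one_mul, iteratedDeriv_zero]
      rfl⟩
  map_add' f g := Subtype.ext <| DFunLike.ext _ _ fun ψ => by
    change ∫ x, ((f : ℝ → ℂ) x + (g : ℝ → ℂ) x) * ψ x = (∫ x, _) + ∫ x, _
    have hb : ∀ f : Baaa, IsBddCont (f : ℝ → ℂ) := fun f => by simpa using (f.2.2 0).1
    rw [← integral_add ((hb f).mul_integrable ψ.integrable) ((hb g).mul_integrable ψ.integrable)]
    simp only [add_mul]
  map_smul' c f := Subtype.ext <| DFunLike.ext _ _ fun ψ => by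
    change ∫ x, (c * (f : ℝ → ℂ) x) * ψ x = c * ∫ x, _
    rw [← integral_const_mul]
    simp only [mul_assoc]

theorem Baaa.toDual_apply (f : Baaa) (ψ : DL1) :
    (Baaa.toDual f : BDual) ψ = ∫ x, (f : ℝ → ℂ) x * ψ x := rfl

/-- The constant families, as a linear map `B_aaa → M_aaa`. -/
def Maaa.const : Baaa →ₗ[ℂ] Maaa where
  toFun f := Maaa.ofFun (fun _ => f) fun k =>
    ⟨0, (IsOPow.const (normK_nonneg k f)).mono (fun _ => le_rfl) (by simp)⟩
  map_add' _ _ := rfl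
  map_smul' _ _ := rfl

/-- The regularization `T ↦ (T * ρ_ε)_ε`, as a linear map `B'_aaa → M_aaa`. -/
def BaaaDual.regularize (ρ : 𝓢(ℝ, ℂ)) : BaaaDual →ₗ[ℂ] Maaa where
  toFun T := Maaa.ofFun (fun ε => BaaaDual.conv (mollifier ρ ε) T) (isModerate_conv_mollifier ρ T)
  map_add' T S := DFunLike.ext _ _ fun ε => (BaaaDual.conv (mollifier ρ ε)).map_add T S
  map_smul' c T := DFunLike.ext _ _ fun ε => (BaaaDual.conv (mollifier ρ ε)).map_smul c T

theorem Gaaa.mk_eq_zero_iff {u : Maaa} : Gaaa.mk u = 0 ↔ IsNull (u : I → Baaa) :=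
  Ideal.Quotient.eq_zero_iff_mem

/-- The sequence `1 / (n + 1)` of parameters. -/
def paramSeq (n : ℕ) : I := ⟨1 / ((n : ℝ) + 1), by positivity, by
  rw [div_le_one (by positivity)]
  linarith [n.cast_nonneg (α := ℝ)]⟩

theorem tendsto_paramSeq : Tendsto (fun n => (paramSeq n : ℝ)) atTop (𝓝 0) :=
  tendsto_one_div_add_atTop_nhds_zero_nat

/-- The case `k = 0`, `m = 1` of nullity: uniform convergence to `0` along a sequence of parameters,
all that injectivity requires. -/
theorem IsNull.exists_eventually_norm_le {u : I → Baaa} (hu : IsNull u) :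
    ∃ c : ℝ, ∀ᶠ n in atTop, ∀ x, ‖(u (paramSeq n) : ℝ → ℂ) x‖ ≤ c * paramSeq n := by
  obtain ⟨c, -, ε₀, H⟩ := hu 0 1
  refine ⟨c, (tendsto_paramSeq.eventually_lt_const ε₀.2.1).mono fun n hn x => ?_⟩
  have h := (supNorm_le_normK le_rfl _).trans (H (paramSeq n) hn)
  rw [iteratedDeriv_zero] at h
  simpa using (le_supNorm (by simpa using ((u (paramSeq n)).2.2 0).1) x).trans h

theorem injective_const : Function.Injective (Gaaa.mk.toLinearMap ∘ₗ Maaa.const) := by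
  refine (injective_iff_map_eq_zero _).2 fun f hf => Subtype.ext <| funext fun x => ?_
  obtain ⟨c, hc⟩ := (Gaaa.mk_eq_zero_iff.1 hf).exists_eventually_norm_le
  have h := tendsto_paramSeq.const_mul c
  rw [mul_zero] at h
  exact norm_le_zero_iff.1 (ge_of_tendsto h (hc.mono fun n hn => hn x))

/-- Tested against `ψ`, the family `T * ρ_ε` tends both to `T ψ` and, by its uniform decay and the
integrability of `ψ`, to `0`. -/
theorem injective_regularize {ρ : 𝓢(ℝ, ℂ)} (hρ : ∫ x, ρ x = 1) :
    Function.Injective (Gaaa.mk.toLinearMap ∘ₗ BaaaDual.regularize ρ) := by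
  refine (injective_iff_map_eq_zero _).2 fun T hT => Subtype.ext <| DFunLike.ext _ _ fun ψ => ?_
  obtain ⟨c, hc⟩ := (Gaaa.mk_eq_zero_iff.1 hT).exists_eventually_norm_le
  have h := (tendsto_paramSeq.const_mul c).mul_const (∫ x, ‖ψ x‖)
  rw [mul_zero, zero_mul] at h
  refine tendsto_nhds_unique (tendsto_integral_conv_mollifier_mul hρ T tendsto_paramSeq ψ)
    (squeeze_zero_norm' (hc.mono fun n hn => ?_) h)
  exact norm_integral_mul_le hn ψ.integrable

theorem conv_toDual (f : Baaa) (φ : DL1) :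
    (BaaaDual.conv φ (Baaa.toDual f) : ℝ → ℂ) = cconv f φ :=
  funext fun x => (cconv_eq _ _ x).symm

theorem isNull_regularize_sub_const {ρ : 𝓢(ℝ, ℂ)} (hρ : ∫ x, ρ x = 1)
    (hρ' : ∀ k : ℕ, 1 ≤ k → ∫ x : ℝ, (x : ℂ) ^ k * ρ x = 0) (f : Baaa) :
    IsNull (BaaaDual.regularize ρ (Baaa.toDual f) - Maaa.const f : Maaa) := by
  intro k m
  have hf : IsBddCont (f : ℝ → ℂ) := by simpa using (f.2.2 0).1
  choose C hC0 hC using fun j => exists_norm_cconv_mollifier_sub_le hρ hρ'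
    (contDiff_iteratedDeriv f.2.1 j) (fun i => by
      rw [iteratedDeriv_add_index]
      exact (f.2.2 _).1) m
  refine ⟨(∑ j ∈ Finset.range (k + 1), C j) + 1,
    add_pos_of_nonneg_of_pos (Finset.sum_nonneg fun j _ => hC0 j) one_pos,
    ⟨1, by norm_num⟩, fun ε _ => ?_⟩
  have hε : 0 < (ε : ℝ) := ε.2.1
  have h : normK k ((BaaaDual.regularize ρ (Baaa.toDual f) - Maaa.const f : Maaa) ε : ℝ → ℂ) ≤
      (∑ j ∈ Finset.range (k + 1), C j) * (ε : ℝ) ^ m := by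
    rw [Finset.sum_mul]
    refine Finset.sum_le_sum fun j _ => supNorm_le fun x => ?_
    have h1 : ((BaaaDual.regularize ρ (Baaa.toDual f) - Maaa.const f : Maaa) ε : ℝ → ℂ) =
        cconv f (mollifier ρ ε) - (f : ℝ → ℂ) := by
      rw [← conv_toDual]
      rfl
    rw [h1, iteratedDeriv_sub (contDiffAt_nat (contDiff_cconv hf _) j x)
      (contDiffAt_nat f.2.1 j x), iteratedDeriv_cconv hf, ← cconv_iteratedDeriv_left]
    -- The estimate for `f^{(j)}` gives `ε ^ (m + 1)`, which is at most `ε ^ m` since `ε ≤ 1`.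
    exact (hC j ε x).trans (mul_le_mul_of_nonneg_left
      (pow_le_pow_of_le_one hε.le ε.2.2 m.le_succ) (hC0 j))
  rw [zpow_natCast]
  exact h.trans (mul_le_mul_of_nonneg_right (by linarith) (by positivity))

end AAA

end

theorem proposition3p3 (ρ : 𝓢(ℝ, ℂ)) (hρ : ∫ x, ρ x = 1)
    (hρ' : ∀ k : ℕ, 1 ≤ k → ∫ x : ℝ, (x : ℂ) ^ k * ρ x = 0) :
    ∃ (σ : AAA.Baaa →ₗ[ℂ] AAA.Gaaa) (γ : AAA.Baaa →ₗ[ℂ] AAA.BaaaDual)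
      (ι : AAA.BaaaDual →ₗ[ℂ] AAA.Gaaa),
      -- the three maps are well defined by the prescribed formulas
      (∀ f : AAA.Baaa, ∃ u : AAA.Maaa,
        (∀ ε : AAA.I, u ε = f) ∧ σ f = AAA.Gaaa.mk u) ∧
      (∀ (f : AAA.Baaa) (ψ : AAA.DL1),
        (γ f : AAA.BDual) ψ = ∫ x, (f : ℝ → ℂ) x * ψ x) ∧
      (∀ T : AAA.BaaaDual, ∃ u : AAA.Maaa,
        (∀ ε : AAA.I, (u ε : ℝ → ℂ) =
          AAA.BDual.conv T (AAA.mollifier ρ ε)) ∧ ι T = AAA.Gaaa.mk u) ∧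
      -- they are embeddings and the diagram commutes
      Function.Injective σ ∧ Function.Injective γ ∧ Function.Injective ι ∧
      ι ∘ₗ γ = σ ∧
      -- `ι` commutes with derivatives
      ∀ (j : ℕ) (T : AAA.BaaaDual), ι (AAA.BaaaDual.iterD j T) = AAA.Gaaa.iterD j (ι T) := by
  have hcomm : (AAA.Gaaa.mk.toLinearMap ∘ₗ AAA.BaaaDual.regularize ρ) ∘ₗ AAA.Baaa.toDual =
      AAA.Gaaa.mk.toLinearMap ∘ₗ AAA.Maaa.const := LinearMap.ext fun f => by
    refine sub_eq_zero.1 (Eq.trans (map_sub AAA.Gaaa.mk _ _).symm ?_)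
    exact AAA.Gaaa.mk_eq_zero_iff.2 (AAA.isNull_regularize_sub_const hρ hρ' f)
  refine ⟨AAA.Gaaa.mk.toLinearMap ∘ₗ AAA.Maaa.const, AAA.Baaa.toDual,
    AAA.Gaaa.mk.toLinearMap ∘ₗ AAA.BaaaDual.regularize ρ,
    fun f => ⟨AAA.Maaa.const f, fun _ => rfl, rfl⟩, AAA.Baaa.toDual_apply,
    fun T => ⟨AAA.BaaaDual.regularize ρ T, fun _ => rfl, rfl⟩, AAA.injective_const, ?_,
    AAA.injective_regularize hρ, hcomm, fun j T => ?_⟩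
  -- Since `ι ∘ γ = σ` is injective, so is its first factor `γ`.
  · have h := AAA.injective_const
    rw [← hcomm, LinearMap.coe_comp] at h
    exact h.of_comp
  · refine Eq.trans (congrArg AAA.Gaaa.mk ?_) (AAA.Gaaa.iterD_mk j _).symm
    exact DFunLike.ext _ _ fun ε => AAA.BaaaDual.conv_iterD (AAA.mollifier ρ ε) j T
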